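/- Fix $\Lambda\in\mathbb{R}$ and a smooth Lagrangian $\mathcal{L}$ defined on an open set $D\subseteq\mathbb{R}$, and write $\mathcal{L}_F=d\mathcal{L}/dF$. A smooth Lorentzian metric $g$ and a smooth closed two-form $\mathbf{F}$ whose invariant $F=F_{\mu\nu}F^{\mu\nu}$ takes values in $D$ are said to solve the Einstein–nonlinear-electrodynamics (NE) equations if $$G^{\mu}{}_{\nu}=T^{\mu}{}_{\nu}-\Lambda\delta^{\mu}{}_{\nu},\qquad T^{\mu}{}_{\nu}=\tfrac12\{\delta^{\mu}{}_{\nu}\mathcal{L}-4(F_{\nu\lambda}F^{\mu\lambda})\mathcal{L}_F\},\qquad \partial_\mu(\sqrt{-g}\,\mathcal{L}_F F^{\mu\nu})=0 .$$ Let $f(c;r)$ and $\tilde E(c;r)$ be smooth functions on an open set $W$ of pairs $(c,r)$, where $c=(c_1,\dots,c_k)\in\mathbb{R}^k$ ($k\ge 0$) are the integration constants and $r>0$, with $-2\tilde E^2\in D$ on $W$. Suppose that for every fixed $c$ the static spherically symmetric metric $$ds^2=-N\,dt^2+\frac{dr^2}{N}+r^2(d\theta^2+\sin^2\theta\,d\phi^2),\qquad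 N(r)=1-\tfrac{\Lambda}{3}r^2+f(c;r),$$ with the field $\mathbf{F}=\tilde E(c;r)\,dt\wedge dr$ solves the Einstein–NE equations for $(c,r)\in W$, $0<\theta<\pi$, away from the zeros of $N$, and that the radii $r$ with $(c,r)\in W$ and $N(r)\neq0$ are dense among those with $(c,r)\in W$. Let $P(u,x,y)>0$ be smooth on an open set $S\subseteq\mathbb{R}^3$, and let $m(u)$ and $c(u)\in\mathbb{R}^k$ be smooth on an open set containing the values of $u$ that occur in $S$. Put $\Delta=P^2(\partial_{xx}+\partial_{yy})$ and let $$ds^2_{RT}=-2H\,du^2-2\,du\,dr+\frac{r^2}{P^2}(dx^2+dy^2),\qquad 2H=\Delta(\ln P)-2r(\ln P)_{,u}-\frac{2m}{r}-\frac{\Lambda}{3}r^2 .$$ Assume the Robinson–Trautman equation $\Delta\Delta(\ln P)+12m(\ln P)_{,u}-4m_{,u}=0$ on $S$. Promote the integration constants to functions of $u$: $Q(u,r)=f(c(u);r)$ and $E(u,r)=\tilde E(c(u);r)$. If $$(\ln P)_{,u}\,\{r\,Q_{,r}-2Q\}+Q_{,u}=0$$ whenever $(u,x,y)\in S$ and $(c(u),r)\in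 W$, then the metric $ds^2=ds^2_{RT}-Q(u,r)\,du^2$ with the Maxwell field $\mathbf{F}=E(u,r)\,du\wedge dr$ solves the Einstein–NE equations, with the same $\Lambda$ and $\mathcal{L}$, on the set of all $(u,r,x,y)$ with $(u,x,y)\in S$ and $(c(u),r)\in W$. -/

import Mathlib

open scoped ContDiff

/-! Coordinate tensor calculus on open subsets of four-dimensional coordinate space. -/

/-- The partial derivative of `h` with respect to the `i`-th coordinate. -/
noncomputable def pd (i : Fin 4) (h : (Fin 4 → ℝ) → ℝ) (x : Fin 4 → ℝ) : ℝ :=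
  deriv (fun s => h (Function.update x i s)) (x i)

/-- The components of a covariant two-tensor field in the coordinates. -/
abbrev TwoTensor : Type := (Fin 4 → ℝ) → Matrix (Fin 4) (Fin 4) ℝ

/-- Christoffel symbols of the second kind, upper index first. -/
noncomputable def christoffel (g : TwoTensor) (a b c : Fin 4) (x : Fin 4 → ℝ) : ℝ :=
  ∑ d, (g x)⁻¹ a d *
    (pd b (fun y => g y d c) x + pd c (fun y => g y d b) x - pd d (fun y => g y b c) x) / 2

/-- Ricci tensor, both indices down. -/
noncomputable def ricci (g : TwoTensor) (a b : Fin 4) (x : Fin 4 → ℝ) : ℝ :=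
  ∑ c, (pd c (christoffel g c a b) x - pd b (christoffel g c a c) x +
    ∑ d, (christoffel g c c d x * christoffel g d a b x
      - christoffel g c b d x * christoffel g d a c x))

/-- Ricci tensor with the first index raised. -/
noncomputable def ricciMixed (g : TwoTensor) (a b : Fin 4) (x : Fin 4 → ℝ) : ℝ :=
  ∑ d, (g x)⁻¹ a d * ricci g d b x

/-- The Ricci scalar. -/
noncomputable def ricciScalar (g : TwoTensor) (x : Fin 4 → ℝ) : ℝ :=
  ∑ a, ricciMixed g a a x

/-- The Kronecker delta. -/
def kronecker (a b : Fin 4) : ℝ := if a = b then 1 else 0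

/-- Einstein tensor with the first index raised. -/
noncomputable def einsteinMixed (g : TwoTensor) (a b : Fin 4) (x : Fin 4 → ℝ) : ℝ :=
  ricciMixed g a b x - kronecker a b * ricciScalar g x / 2

/-- A symmetric matrix of signature `(-,+,+,+)`. -/
def IsLorentzian (A : Matrix (Fin 4) (Fin 4) ℝ) : Prop :=
  A.IsSymm ∧ ∃ B : Matrix (Fin 4) (Fin 4) ℝ, IsUnit B.det ∧
    B.transpose * A * B = Matrix.diagonal ![-1, 1, 1, 1]

/-! Nonlinear electrodynamics with Lagrangian `L`, a function of the invariant `F_{μν} F^{μν}`. -/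

/-- The field with both indices raised. -/
noncomputable def raised (g F : TwoTensor) (a b : Fin 4) (x : Fin 4 → ℝ) : ℝ :=
  ∑ c, ∑ d, (g x)⁻¹ a c * (g x)⁻¹ b d * F x c d

/-- The electromagnetic invariant `F_{μν} F^{μν}`. -/
noncomputable def fieldInvariant (g F : TwoTensor) (x : Fin 4 → ℝ) : ℝ :=
  ∑ a, ∑ b, F x a b * raised g F a b x

/-- Energy-momentum tensor `T^a_b = ½ (δ^a_b L - 4 F_{bc} F^{ac} L_F)`. -/
noncomputable def energyMomentum (L : ℝ → ℝ) (g F : TwoTensor) (a b : Fin 4)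
    (x : Fin 4 → ℝ) : ℝ :=
  (kronecker a b * L (fieldInvariant g F x)
    - 4 * (∑ c, F x b c * raised g F a c x) * deriv L (fieldInvariant g F x)) / 2

/-- The metric `g` and the Maxwell two-form `F` are smooth on the open set `Ω` and solve there the
Einstein equations with cosmological constant `Λ` coupled to nonlinear electrodynamics with
Lagrangian `L`, defined on `D`. -/
structure IsEinsteinNESolution (Λ : ℝ) (L : ℝ → ℝ) (D : Set ℝ) (Ω : Set (Fin 4 → ℝ))
    (g F : TwoTensor) : Prop where
  isOpen_domain : IsOpen Ω
  metric_smooth : ∀ a b, ContDiffOn ℝ ∞ (fun x => g x a b) Ω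
  metric_lorentzian : ∀ x ∈ Ω, IsLorentzian (g x)
  field_smooth : ∀ a b, ContDiffOn ℝ ∞ (fun x => F x a b) Ω
  field_antisymm : ∀ x ∈ Ω, ∀ a b, F x a b = -F x b a
  field_closed : ∀ x ∈ Ω, ∀ a b c,
    pd a (fun y => F y b c) x + pd b (fun y => F y c a) x + pd c (fun y => F y a b) x = 0
  invariant_mem : ∀ x ∈ Ω, fieldInvariant g F x ∈ D
  einstein_eq : ∀ x ∈ Ω, ∀ a b,
    einsteinMixed g a b x = energyMomentum L g F a b x - Λ * kronecker a b
  maxwell_eq : ∀ x ∈ Ω, ∀ b,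
    ∑ a, pd a (fun y => Real.sqrt (-(g y).det) * deriv L (fieldInvariant g F y)
      * raised g F a b y) x = 0

/-! Static spherically symmetric fields, in the coordinates `(t, r, θ, φ)`. -/

/-- The function `1 - (Λ/3) r² + f(r)`. -/
noncomputable def lapse (Λ : ℝ) (f : ℝ → ℝ) (r : ℝ) : ℝ := 1 - Λ / 3 * r ^ 2 + f r

/-- `-N dt² + dr²/N + r² (dθ² + sin² θ dφ²)` with `N = 1 - (Λ/3) r² + f(r)`. -/
noncomputable def sssMetric (Λ : ℝ) (f : ℝ → ℝ) : TwoTensor := fun x =>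
  Matrix.diagonal ![-lapse Λ f (x 1), (lapse Λ f (x 1))⁻¹, x 1 ^ 2,
    x 1 ^ 2 * Real.sin (x 2) ^ 2]

/-- The two-form `ε dx⁰ ∧ dx¹`. -/
def radialField (ε : ℝ → ℝ → ℝ) : TwoTensor := fun x =>
  !![0, ε (x 0) (x 1), 0, 0;
     -ε (x 0) (x 1), 0, 0, 0;
     0, 0, 0, 0;
     0, 0, 0, 0]

/-- The coordinate domain of a static spherically symmetric metric with radial coordinate in `R`:
the horizons and the axis are left out. -/
def sssDomain (Λ : ℝ) (f : ℝ → ℝ) (R : Set ℝ) : Set (Fin 4 → ℝ) :=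
  {x | x 1 ∈ R ∧ lapse Λ f (x 1) ≠ 0 ∧ 0 < x 2 ∧ x 2 < Real.pi}

/-- `f` and `E` give a static spherically symmetric solution with radial coordinate in `R`. At a
horizon the static coordinates break down, and the field equations are imposed away from it;
horizons are nowhere dense in `R`. -/
def IsSSSSolution (Λ : ℝ) (L : ℝ → ℝ) (D : Set ℝ) (R : Set ℝ) (f E : ℝ → ℝ) : Prop :=
  R ⊆ closure {r ∈ R | lapse Λ f r ≠ 0} ∧
  IsEinsteinNESolution Λ L D (sssDomain Λ f R) (sssMetric Λ f) (radialField fun _ r => E r)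

/-! Robinson--Trautman fields, in the coordinates `(u, r, x, y)`. -/

/-- The operator `Δ = P² (∂_xx + ∂_yy)`. -/
noncomputable def rtLaplacian (P h : ℝ → ℝ → ℝ → ℝ) (u x y : ℝ) : ℝ :=
  P u x y ^ 2 * (deriv (deriv fun s => h u s y) x + deriv (deriv fun s => h u x s) y)

/-- The function `ln P`. -/
noncomputable def logP (P : ℝ → ℝ → ℝ → ℝ) (u x y : ℝ) : ℝ := Real.log (P u x y)

/-- The derivative `(ln P)_{,u}`. -/
noncomputable def logPu (P : ℝ → ℝ → ℝ → ℝ) (u x y : ℝ) : ℝ := deriv (fun s => logP P s x y) u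

/-- `2H = Δ ln P - 2 r (ln P)_{,u} - 2 m / r - (Λ/3) r²`. -/
noncomputable def twoH (Λ : ℝ) (P : ℝ → ℝ → ℝ → ℝ) (m : ℝ → ℝ) (u r x y : ℝ) : ℝ :=
  rtLaplacian P (logP P) u x y - 2 * r * logPu P u x y - 2 * m u / r - Λ / 3 * r ^ 2

/-- The Robinson--Trautman metric `-2H du² - 2 du dr + (r²/P²) (dx² + dy²)`. -/
noncomputable def rtMetric (Λ : ℝ) (P : ℝ → ℝ → ℝ → ℝ) (m : ℝ → ℝ) : TwoTensor := fun x =>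
  !![-twoH Λ P m (x 0) (x 1) (x 2) (x 3), -1, 0, 0;
     -1, 0, 0, 0;
     0, 0, x 1 ^ 2 / P (x 0) (x 2) (x 3) ^ 2, 0;
     0, 0, 0, x 1 ^ 2 / P (x 0) (x 2) (x 3) ^ 2]

/-- The metric `ds²_RT - Q(u,r) du²`. -/
noncomputable def rtModifiedMetric (Λ : ℝ) (P : ℝ → ℝ → ℝ → ℝ) (m : ℝ → ℝ) (Q : ℝ → ℝ → ℝ) :
    TwoTensor := fun x =>
  rtMetric Λ P m x - Q (x 0) (x 1) • Matrix.single 0 0 1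

/-- The Robinson--Trautman equation `ΔΔ ln P + 12 m (ln P)_{,u} - 4 m_{,u} = 0`. -/
def RTEquation (P : ℝ → ℝ → ℝ → ℝ) (m : ℝ → ℝ) (u x y : ℝ) : Prop :=
  rtLaplacian P (rtLaplacian P (logP P)) u x y + 12 * m u * logPu P u x y - 4 * deriv m u = 0

/-- The constraint `(ln P)_{,u} (r Q_{,r} - 2 Q) + Q_{,u} = 0`. -/
def RTConstraint (P : ℝ → ℝ → ℝ → ℝ) (Q : ℝ → ℝ → ℝ) (u r x y : ℝ) : Prop :=
  logPu P u x y * (r * deriv (fun s => Q u s) r - 2 * Q u r) + deriv (fun s => Q s r) u = 0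

/-! For a field `E dx⁰ ∧ dx¹` whose `(0, 1)` metric block has determinant `-1`, raising both indices
only changes the sign, so the invariant is `-2E²` and the energy-momentum tensor is diagonal with
one eigenvalue on each two-dimensional block. This covers both the static metrics and the modified
Robinson–Trautman metrics, and the theorem compares the two.

Static side (`sss_field_equations`): the equations reduce to (A) `f''/2 + f'/r = L/2`, (B) `f'/r +
f/r² = L/2 + 2E² L_F`, (M) `q' = 0` for the charge `q = r² L_F E`. The lapse no longer divides
anything, so they extend by continuity to the horizons.

Robinson–Trautman side: with `p = ln P` and `h = 2H + Q`, the `ur` and transverse components of the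
Ricci tensor are affine in `h`, and `Q` enters them through the left sides of (A) and (B), read at
`c(u)`. The `uu` component also contains `u`-derivatives; what they leave over is a combination of
the Robinson–Trautman equation and the constraint on `Q` (`nullRicci_rtPotential`). This gives the
Einstein equations.

Maxwell side: the flux density is `q/P²` up to sign. Its `r`-derivative vanishes by (M); its
`u`-derivative vanishes if `q_{,u} = 2 p_{,u} q`. The constraint says that `Q` has weight two under
`∂_u + p_{,u} r ∂_r`. Differentiating (A) and (B) in `u`, with this rule for `Q`, gives the law for
`q` multiplied by `E` (`pd_charge_mul_field`). The factor `E` is removed by continuity near points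
where `E ≠ 0`; where `E` vanishes identically nearby, so does `q`. -/

open Filter Topology

/-! Calculus of the partial derivatives `pd`. -/

section PartialDerivatives

variable {f g : (Fin 4 → ℝ) → ℝ} {x : Fin 4 → ℝ} {i j : Fin 4}

/-- `pd` depends only on the germ of the function, so an identity valid on an open set may be
differentiated. -/
theorem pd_congr (h : f =ᶠ[𝓝 x] g) : pd i f x = pd i g x := by
  have hc : Tendsto (fun s => Function.update x i s) (𝓝 (x i)) (𝓝 x) := by
    have := (continuous_const.update i continuous_id : Continuous fun s : ℝ =>
      Function.update x i s).tendsto (x i)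
    simpa using this
  exact (show (fun s => f (Function.update x i s)) =ᶠ[𝓝 (x i)] _ from
    hc.eventually h).deriv_eq

theorem HasFDerivAt.hasDerivAt_comp_update {f' : (Fin 4 → ℝ) →L[ℝ] ℝ} (h : HasFDerivAt f f' x) :
    HasDerivAt (fun s => f (Function.update x i s)) (f' (Pi.single i 1)) (x i) := by
  have h1 : HasFDerivAt f f' (Function.update x i (x i)) := by simpa using h
  exact h1.comp_hasDerivAt (x i) (hasDerivAt_update x i (x i))

theorem pd_eq_fderiv (h : DifferentiableAt ℝ f x) : pd i f x = fderiv ℝ f x (Pi.single i 1) :=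
  h.hasFDerivAt.hasDerivAt_comp_update.deriv

theorem ContDiffAt.differentiableAt_update (h : ContDiffAt ℝ ∞ f x) :
    DifferentiableAt ℝ (fun s => f (Function.update x i s)) (x i) :=
  (h.differentiableAt (by simp)).hasFDerivAt.hasDerivAt_comp_update.differentiableAt

theorem ContDiffAt.eventually_contDiffAt (h : ContDiffAt ℝ ∞ f x) :
    ∀ᶠ y in 𝓝 x, DifferentiableAt ℝ f y := by
  have h1 : ContDiffAt ℝ 1 f x := h.of_le (by exact_mod_cast le_top)
  filter_upwards [h1.eventually (by simp)] with y hy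
  exact hy.differentiableAt (by simp)

/-- `pd` is a one-variable `deriv`, controlled only where the function is differentiable; smoothness
at a point gives this nearby, which is enough to iterate `pd`. -/
theorem ContDiffAt.pd_eventuallyEq (h : ContDiffAt ℝ ∞ f x) :
    pd i f =ᶠ[𝓝 x] fun y => fderiv ℝ f y (Pi.single i 1) := by
  filter_upwards [h.eventually_contDiffAt] with y hy using pd_eq_fderiv hy

theorem ContDiffAt.pd (h : ContDiffAt ℝ ∞ f x) : ContDiffAt ℝ ∞ (pd i f) x := by
  have h1 : ContDiffAt ℝ ∞ (fderiv ℝ f) x := h.fderiv_right (by simp)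
  exact (h1.clm_apply contDiffAt_const).congr_of_eventuallyEq h.pd_eventuallyEq

theorem pd_comm (h : ContDiffAt ℝ ∞ f x) : pd i (pd j f) x = pd j (pd i f) x := by
  have h1 : DifferentiableAt ℝ (fderiv ℝ f) x :=
    (h.fderiv_right (m := ∞) (by simp)).differentiableAt (by simp)
  have key : ∀ k l : Fin 4, _root_.pd k (_root_.pd l f) x
      = fderiv ℝ (fderiv ℝ f) x (Pi.single k 1) (Pi.single l 1) := by
    intro k l
    rw [pd_congr h.pd_eventuallyEq, pd_eq_fderiv (h1.clm_apply (differentiableAt_const _)),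
      fderiv_clm_apply h1 (differentiableAt_const _)]
    simp
  rw [key, key]
  exact (h.isSymmSndFDerivAt (by simpa using (WithTop.coe_le_coe (α := ℕ∞) (a := ⊤) (b := 2)).2 le_top)).eq _ _

theorem pd_const (c : ℝ) : pd i (fun _ => c) x = 0 := by simp [pd]

theorem pd_coord : pd i (fun y => y j) x = if i = j then 1 else 0 := by
  unfold pd
  split_ifs with h
  · subst h; simp
  · simp [Function.update_of_ne (Ne.symm h)]

theorem pd_neg : pd i (fun y => -f y) x = -pd i f x := by simp [pd]

theorem pd_div_const (c : ℝ) : pd i (fun y => f y / c) x = pd i f x / c := by simp [pd]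

theorem pd_const_mul (c : ℝ) : pd i (fun y => c * f y) x = c * pd i f x := by
  simp [pd]

theorem pd_add (hf : ContDiffAt ℝ ∞ f x) (hg : ContDiffAt ℝ ∞ g x) :
    pd i (fun y => f y + g y) x = pd i f x + pd i g x :=
  deriv_fun_add hf.differentiableAt_update hg.differentiableAt_update

theorem pd_sub (hf : ContDiffAt ℝ ∞ f x) (hg : ContDiffAt ℝ ∞ g x) :
    pd i (fun y => f y - g y) x = pd i f x - pd i g x :=
  deriv_fun_sub hf.differentiableAt_update hg.differentiableAt_update

theorem pd_mul (hf : ContDiffAt ℝ ∞ f x) (hg : ContDiffAt ℝ ∞ g x) :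
    pd i (fun y => f y * g y) x = pd i f x * g x + f x * pd i g x := by
  have := deriv_fun_mul (hf.differentiableAt_update (i := i)) (hg.differentiableAt_update (i := i))
  simpa [pd] using this

theorem pd_div (hf : ContDiffAt ℝ ∞ f x) (hg : ContDiffAt ℝ ∞ g x) (h0 : g x ≠ 0) :
    pd i (fun y => f y / g y) x = (pd i f x * g x - f x * pd i g x) / g x ^ 2 := by
  have := deriv_fun_div (hf.differentiableAt_update (i := i)) (hg.differentiableAt_update (i := i))
    (by simpa using h0)
  simpa [pd] using this

theorem pd_pow (hf : ContDiffAt ℝ ∞ f x) (n : ℕ) :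
    pd i (fun y => f y ^ n) x = n * f x ^ (n - 1) * pd i f x := by
  have := deriv_fun_pow (hf.differentiableAt_update (i := i)) n
  simpa [pd] using this

theorem pd_comp {φ : ℝ → ℝ} (hφ : DifferentiableAt ℝ φ (f x)) (hf : ContDiffAt ℝ ∞ f x) :
    pd i (fun y => φ (f y)) x = deriv φ (f x) * pd i f x := by
  have := deriv_comp (x i) (h₂ := φ) (by simpa using hφ) (hf.differentiableAt_update (i := i))
  simpa [pd, Function.comp_def] using this

theorem pd_comp_coord_of_ne (h : i ≠ j) {φ : ℝ → ℝ} : pd i (fun y => φ (y j)) x = 0 := by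
  simp [pd, Function.update_of_ne (Ne.symm h)]

theorem pd_comp_coord {φ : ℝ → ℝ} : pd i (fun y => φ (y i)) x = deriv φ (x i) := by
  simp [pd]

theorem contDiffAt_coord : ContDiffAt ℝ ∞ (fun y : Fin 4 → ℝ => y j) x :=
  contDiffAt_apply ℝ ℝ j x

end PartialDerivatives

/-! ### Curvature of metrics in null form -/

/-- The metric `-h du² - 2 du dr + G (dx² + dy²)`. -/
def nullMetric (h G : (Fin 4 → ℝ) → ℝ) : TwoTensor := fun x =>
  !![-h x, -1, 0, 0;
     -1, 0, 0, 0;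
     0, 0, G x, 0;
     0, 0, 0, G x]

theorem nullMetric_inv {h G : (Fin 4 → ℝ) → ℝ} {x : Fin 4 → ℝ} (hG : G x ≠ 0) :
    (nullMetric h G x)⁻¹ = !![0, -1, 0, 0; -1, h x, 0, 0; 0, 0, 1 / G x, 0; 0, 0, 0, 1 / G x] := by
  apply Matrix.inv_eq_right_inv
  ext a b
  fin_cases a <;> fin_cases b <;>
    simp [nullMetric, Matrix.mul_apply, Fin.sum_univ_four, hG]

theorem nullMetric_det (h G : (Fin 4 → ℝ) → ℝ) (x : Fin 4 → ℝ) :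
    (nullMetric h G x).det = -G x ^ 2 := by
  simp [nullMetric, Matrix.det_succ_row_zero, Fin.sum_univ_succ, Fin.succAbove]
  ring

/-- The Christoffel symbols of `nullMetric h G` when `G = r² e^{-2p}` and `p` does not depend
on `r`. -/
noncomputable def nullChristoffel (h p G : (Fin 4 → ℝ) → ℝ) (a b c : Fin 4) (x : Fin 4 → ℝ) : ℝ :=
  match a with
  | 0 => !![-pd 1 h x / 2, 0, 0, 0; 0, 0, 0, 0; 0, 0, G x / x 1, 0; 0, 0, 0, G x / x 1] b c
  | 1 => !![(pd 0 h x + h x * pd 1 h x) / 2, pd 1 h x / 2, pd 2 h x / 2, pd 3 h x / 2;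
      pd 1 h x / 2, 0, 0, 0;
      pd 2 h x / 2, 0, -(pd 0 p x + h x / x 1) * G x, 0;
      pd 3 h x / 2, 0, 0, -(pd 0 p x + h x / x 1) * G x] b c
  | 2 => !![pd 2 h x / G x / 2, 0, -pd 0 p x, 0;
      0, 0, 1 / x 1, 0;
      -pd 0 p x, 1 / x 1, -pd 2 p x, -pd 3 p x;
      0, 0, -pd 3 p x, pd 2 p x] b c
  | 3 => !![pd 3 h x / G x / 2, 0, 0, -pd 0 p x;
      0, 0, 0, 1 / x 1;
      0, 0, pd 3 p x, -pd 2 p x;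
      -pd 0 p x, 1 / x 1, -pd 2 p x, -pd 3 p x] b c

/-- The first derivatives of `G` are those of `r² e^{-2p}` with `p` independent of `r`. -/
structure IsConformalFactor (p G : (Fin 4 → ℝ) → ℝ) (x : Fin 4 → ℝ) : Prop where
  coord_ne : x 1 ≠ 0
  ne_zero : G x ≠ 0
  pd_zero : pd 0 G x = -2 * pd 0 p x * G x
  pd_one : pd 1 G x = 2 / x 1 * G x
  pd_two : pd 2 G x = -2 * pd 2 p x * G x
  pd_three : pd 3 G x = -2 * pd 3 p x * G x

theorem christoffel_nullMetric {h p G : (Fin 4 → ℝ) → ℝ} {x : Fin 4 → ℝ}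
    (hG : IsConformalFactor p G x) (a b c : Fin 4) :
    christoffel (nullMetric h G) a b c x = nullChristoffel h p G a b c x := by
  obtain ⟨hx, h0, hG0, hG1, hG2, hG3⟩ := hG
  unfold christoffel
  rw [nullMetric_inv h0]
  fin_cases a <;> fin_cases b <;> fin_cases c <;>
    simp [nullMetric, nullChristoffel, Fin.sum_univ_four, pd_const, pd_neg,
      hG0, hG1, hG2, hG3] <;> field_simp <;> ring

/-- The Ricci tensor of `nullMetric h G` when `G = r² e^{-2p}` and `p` does not depend on `r`. -/
noncomputable def nullRicci (h p G : (Fin 4 → ℝ) → ℝ) (x : Fin 4 → ℝ) :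
    Matrix (Fin 4) (Fin 4) ℝ :=
  let ur := pd 1 (pd 1 h) x / 2 + pd 1 h x / x 1 + 2 * pd 0 p x / x 1
  let uu := h x * (pd 1 (pd 1 h) x / 2 + pd 1 h x / x 1)
    + (pd 2 (pd 2 h) x + pd 3 (pd 3 h) x) / G x / 2
    + 2 * pd 0 (pd 0 p) x + pd 0 p x * pd 1 h x + pd 0 h x / x 1 - 2 * pd 0 p x ^ 2
  let ux := pd 1 (pd 2 h) x / 2 + pd 0 (pd 2 p) x
  let uy := pd 1 (pd 3 h) x / 2 + pd 0 (pd 3 p) x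
  let xx := pd 2 (pd 2 p) x + pd 3 (pd 3 p) x
    - G x * (h x + x 1 * pd 1 h x + 4 * pd 0 p x * x 1) / x 1 ^ 2
  !![uu, ur, ux, uy; ur, 0, 0, 0; ux, 0, xx, 0; uy, 0, 0, xx]

/-- Curvature differentiates the Christoffel symbols, so the relations for `p` and `G` are needed on
a neighbourhood. They eliminate every derivative of `G`. -/
theorem ricci_nullMetric {h p G : (Fin 4 → ℝ) → ℝ} {x : Fin 4 → ℝ}
    (hh : ContDiffAt ℝ ∞ h x) (hp : ContDiffAt ℝ ∞ p x) (hG : ContDiffAt ℝ ∞ G x)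
    (hp1 : ∀ᶠ y in 𝓝 x, pd 1 p y = 0) (hGp : ∀ᶠ y in 𝓝 x, IsConformalFactor p G y)
    (a b : Fin 4) : ricci (nullMetric h G) a b x = nullRicci h p G x a b := by
  have hΓ : ∀ i a b c, pd i (christoffel (nullMetric h G) a b c) x
      = pd i (fun y => nullChristoffel h p G a b c y) x := by
    intro i a b c
    apply pd_congr
    filter_upwards [hGp] with y hy using christoffel_nullMetric hy a b c
  have hΓ0 := fun a b c => christoffel_nullMetric (h := h) hGp.self_of_nhds a b c
  unfold ricci
  simp only [hΓ, hΓ0]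
  obtain ⟨hx, h0, hG0, hG1, hG2, hG3⟩ := hGp.self_of_nhds
  have hp1' : ∀ i, pd i (pd 1 p) x = 0 := by
    intro i
    rw [pd_congr (g := fun _ => 0) hp1, pd_const]
  have hp1'' : ∀ i, pd 1 (pd i p) x = 0 := by
    intro i
    rw [pd_comm hp, hp1']
  have hp10 := hp1.self_of_nhds
  have hdh : ∀ i, ContDiffAt ℝ ∞ (pd i h) x := fun i => hh.pd
  have hdp : ∀ i, ContDiffAt ℝ ∞ (pd i p) x := fun i => hp.pd
  have hr : ContDiffAt ℝ ∞ (fun y : Fin 4 → ℝ => y 1) x := contDiffAt_coord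
  have hc : ∀ c : ℝ, ContDiffAt ℝ ∞ (fun _ : Fin 4 → ℝ => c) x := fun c => contDiffAt_const
  have hGr : ContDiffAt ℝ ∞ (fun y => G y / y 1) x := hG.div hr hx
  have hhr : ContDiffAt ℝ ∞ (fun y => h y / y 1) x := hh.div hr hx
  have hhh : ContDiffAt ℝ ∞ (fun y => h y * pd 1 h y) x := hh.mul hh.pd
  have hinv : ∀ i, pd i (fun y : Fin 4 → ℝ => (y 1)⁻¹) x
      = -(if i = 1 then 1 else 0) / x 1 ^ 2 := by
    intro i
    have := pd_div (i := i) (hc 1) hr hx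
    simpa [pd_const, pd_coord] using this
  have h2G : ContDiffAt ℝ ∞ (fun y => pd 2 h y / G y) x := hh.pd.div hG h0
  have h3G : ContDiffAt ℝ ∞ (fun y => pd 3 h y / G y) x := hh.pd.div hG h0
  -- Fixed instances give `simp` one order for the mixed derivatives, the one used in `nullRicci`.
  have e10 := pd_comm (i := 1) (j := 0) hh
  have e21 := pd_comm (i := 2) (j := 1) hh
  have e31 := pd_comm (i := 3) (j := 1) hh
  have p20 := pd_comm (i := 2) (j := 0) hp
  have p30 := pd_comm (i := 3) (j := 0) hp
  have p32 := pd_comm (i := 3) (j := 2) hp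
  -- The transverse entry of `Γ^r`, in the form to which `simp` brings it.
  have hsG : ∀ i, pd i (fun y => (-(h y / y 1) + -pd 0 p y) * G y) x = 
      (-((pd i h x * x 1 - h x * if i = 1 then 1 else 0) / x 1 ^ 2) - pd i (pd 0 p) x) * G x
      - (h x / x 1 + pd 0 p x) * pd i G x := by
    intro i
    rw [pd_mul (hhr.neg.add hp.pd.neg) hG, pd_add hhr.neg hp.pd.neg, pd_neg, pd_neg,
      pd_div hh hr hx, pd_coord]
    ring
  fin_cases a <;> fin_cases b <;>
    simp [nullChristoffel, nullRicci, Fin.sum_univ_four, pd_const, pd_neg, pd_div_const,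
      pd_add, pd_mul, pd_div, pd_coord, *] <;> field_simp <;> ring

/-! ### Curvature of static metrics -/

theorem pd_inv {f : (Fin 4 → ℝ) → ℝ} {x : Fin 4 → ℝ} {i : Fin 4} (hf : ContDiffAt ℝ ∞ f x)
    (h0 : f x ≠ 0) : pd i (fun y => (f y)⁻¹) x = -pd i f x / f x ^ 2 := by
  have := pd_div (i := i) (contDiffAt_const (c := (1 : ℝ))) hf h0
  simpa [pd_const] using this

/-- The metric `-N dt² + dr²/N + r² (dθ² + s² dφ²)`. -/
noncomputable def staticMetric (N s : (Fin 4 → ℝ) → ℝ) : TwoTensor := fun x =>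
  Matrix.diagonal ![-N x, (N x)⁻¹, x 1 ^ 2, x 1 ^ 2 * s x ^ 2]

theorem staticMetric_inv {N s : (Fin 4 → ℝ) → ℝ} {x : Fin 4 → ℝ} (hN : N x ≠ 0) (hr : x 1 ≠ 0)
    (hs : s x ≠ 0) : (staticMetric N s x)⁻¹ =
      Matrix.diagonal ![-(N x)⁻¹, N x, (x 1 ^ 2)⁻¹, (x 1 ^ 2 * s x ^ 2)⁻¹] := by
  apply Matrix.inv_eq_right_inv
  rw [staticMetric, Matrix.diagonal_mul_diagonal, ← Matrix.diagonal_one]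
  congr 1
  funext a
  fin_cases a <;> simp [hN, hr]
  field_simp

/-- The two factors of `N` cancel whatever its sign, so regions with `N < 0` need no separate
treatment. -/
theorem staticMetric_det {N s : (Fin 4 → ℝ) → ℝ} {x : Fin 4 → ℝ} (hN : N x ≠ 0) :
    (staticMetric N s x).det = -(x 1 ^ 2 * s x) ^ 2 := by
  rw [staticMetric, Matrix.det_diagonal, Fin.prod_univ_four]
  simp
  field_simp

/-- The Christoffel symbols of `staticMetric N s`, where `N` depends only on `r` and `s` only on
`θ`. -/
noncomputable def staticChristoffel (N s : (Fin 4 → ℝ) → ℝ) (a b c : Fin 4) (x : Fin 4 → ℝ) : ℝ :=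
  match a with
  | 0 => !![0, pd 1 N x / N x / 2, 0, 0; pd 1 N x / N x / 2, 0, 0, 0; 0, 0, 0, 0; 0, 0, 0, 0] b c
  | 1 => !![N x * pd 1 N x / 2, 0, 0, 0; 0, -(pd 1 N x / N x) / 2, 0, 0; 0, 0, -(x 1 * N x), 0;
      0, 0, 0, -(x 1 * N x * s x ^ 2)] b c
  | 2 => !![0, 0, 0, 0; 0, 0, 1 / x 1, 0; 0, 1 / x 1, 0, 0; 0, 0, 0, -(s x * pd 2 s x)] b c
  | 3 => !![0, 0, 0, 0; 0, 0, 0, 1 / x 1; 0, 0, 0, pd 2 s x / s x;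
      0, 1 / x 1, pd 2 s x / s x, 0] b c

/-- Regularity of the coefficients of `staticMetric N s` at a point. -/
structure IsStaticPair (N s : (Fin 4 → ℝ) → ℝ) (x : Fin 4 → ℝ) : Prop where
  coord_ne : x 1 ≠ 0
  lapse_ne : N x ≠ 0
  polar_ne : s x ≠ 0
  lapse_smooth : ContDiffAt ℝ ∞ N x
  polar_smooth : ContDiffAt ℝ ∞ s x
  pd_lapse : ∀ i, i ≠ 1 → pd i N x = 0
  pd_polar : ∀ i, i ≠ 2 → pd i s x = 0

theorem christoffel_staticMetric {N s : (Fin 4 → ℝ) → ℝ} {x : Fin 4 → ℝ}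
    (h : IsStaticPair N s x) (a b c : Fin 4) :
    christoffel (staticMetric N s) a b c x = staticChristoffel N s a b c x := by
  obtain ⟨hx, h0, hs0, hN, hs, hN', hs'⟩ := h
  have hr : ContDiffAt ℝ ∞ (fun y : Fin 4 → ℝ => y 1) x := contDiffAt_coord
  have hr2 : ContDiffAt ℝ ∞ (fun y : Fin 4 → ℝ => y 1 ^ 2) x := hr.pow 2
  have hs2 : ContDiffAt ℝ ∞ (fun y : Fin 4 → ℝ => s y ^ 2) x := hs.pow 2
  unfold christoffel
  rw [staticMetric_inv h0 hx hs0]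
  fin_cases a <;> fin_cases b <;> fin_cases c <;>
    simp [staticMetric, staticChristoffel, Fin.sum_univ_four, pd_const, pd_neg, pd_inv, pd_mul,
      pd_pow, pd_coord, *] <;> field_simp

/-- Two components suffice: with a radial field the Einstein equations have only two distinct
eigenvalues. -/
theorem ricci_staticMetric {N s : (Fin 4 → ℝ) → ℝ} {x : Fin 4 → ℝ}
    (h : ∀ᶠ y in 𝓝 x, IsStaticPair N s y) :
    ricci (staticMetric N s) 0 0 x = N x * (pd 1 (pd 1 N) x / 2 + pd 1 N x / x 1) ∧
    ricci (staticMetric N s) 2 2 x = -(pd 2 (pd 2 s) x / s x) - N x - x 1 * pd 1 N x := by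
  have hΓ : ∀ i a b c, pd i (christoffel (staticMetric N s) a b c) x
      = pd i (fun y => staticChristoffel N s a b c y) x := by
    intro i a b c
    apply pd_congr
    filter_upwards [h] with y hy using christoffel_staticMetric hy a b c
  have hΓ0 := fun a b c => christoffel_staticMetric h.self_of_nhds a b c
  unfold ricci
  simp only [hΓ, hΓ0]
  obtain ⟨hx, h0, hs0, hN, hs, hN', hs'⟩ := h.self_of_nhds
  have hr : ContDiffAt ℝ ∞ (fun y : Fin 4 → ℝ => y 1) x := contDiffAt_coord
  have hdN : ∀ i, ContDiffAt ℝ ∞ (pd i N) x := fun i => hN.pd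
  have hds : ∀ i, ContDiffAt ℝ ∞ (pd i s) x := fun i => hs.pd
  have hNN : ContDiffAt ℝ ∞ (fun y => pd 1 N y / N y) x := hN.pd.div hN h0
  constructor <;>
    simp [staticChristoffel, Fin.sum_univ_four, pd_const, pd_neg, pd_mul, pd_div,
      pd_div_const, pd_coord, *] <;> field_simp <;> ring

/-! ### Trace-reversed Einstein equations with a radial field -/

/-- The trace-reversed form of the Einstein equations. -/
theorem ricciMixed_eq_of_einsteinMixed_eq {g : TwoTensor} {x : Fin 4 → ℝ} {Λ : ℝ}
    {T : Fin 4 → Fin 4 → ℝ} (h : ∀ a b, einsteinMixed g a b x = T a b - Λ * kronecker a b)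
    (a b : Fin 4) : ricciMixed g a b x = T a b + kronecker a b * (Λ - (∑ c, T c c) / 2) := by
  have h1 : ∑ c, einsteinMixed g c c x = -ricciScalar g x := by
    simp only [einsteinMixed, ricciScalar, kronecker, Fin.sum_univ_four, if_true]
    ring
  have h2 : ∑ c, einsteinMixed g c c x = ∑ c, T c c - 4 * Λ := by
    simp only [h, Fin.sum_univ_four, kronecker, if_true]
    ring
  have h3 := h a b
  rw [einsteinMixed] at h3
  linear_combination h3 - kronecker a b / 2 * (h2 - h1)

theorem einsteinMixed_eq_of_ricciMixed_eq {g : TwoTensor} {x : Fin 4 → ℝ} {Λ : ℝ}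
    {T : Fin 4 → Fin 4 → ℝ}
    (h : ∀ a b, ricciMixed g a b x = T a b + kronecker a b * (Λ - (∑ c, T c c) / 2))
    (a b : Fin 4) : einsteinMixed g a b x = T a b - Λ * kronecker a b := by
  have h1 : ricciScalar g x = 4 * Λ - ∑ c, T c c := by
    simp only [ricciScalar, h, Fin.sum_univ_four, kronecker, if_true]
    ring
  rw [einsteinMixed, h, h1]
  ring

section FieldTensors

variable {ε : ℝ → ℝ → ℝ} {g : TwoTensor} {x : Fin 4 → ℝ}

/-- If `g` is block diagonal and its `(u, r)` block has determinant `-1`, raising the indices of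
a radial field changes its sign. -/
theorem raised_radialField {α β δ : ℝ} {A B : ℝ}
    (hg : (g x)⁻¹ = !![α, β, 0, 0; β, δ, 0, 0; 0, 0, A, 0; 0, 0, 0, B])
    (hdet : α * δ - β ^ 2 = -1) (a b : Fin 4) :
    raised g (radialField ε) a b x = -radialField ε x a b := by
  unfold raised
  rw [hg]
  fin_cases a <;> fin_cases b <;> simp [Fin.sum_univ_four, radialField] <;>
    first
      | linear_combination ε (x 0) (x 1) * hdet
      | linear_combination -ε (x 0) (x 1) * hdet
      | ring

theorem fieldInvariant_radialField
    (hF : ∀ a b, raised g (radialField ε) a b x = -radialField ε x a b) :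
    fieldInvariant g (radialField ε) x = -2 * ε (x 0) (x 1) ^ 2 := by
  simp [fieldInvariant, hF, radialField, Fin.sum_univ_four]
  ring

theorem energyMomentum_radialField (L : ℝ → ℝ)
    (hF : ∀ a b, raised g (radialField ε) a b x = -radialField ε x a b) (a b : Fin 4) :
    energyMomentum L g (radialField ε) a b x = kronecker a b *
      (L (-2 * ε (x 0) (x 1) ^ 2) / 2
        + 2 * ε (x 0) (x 1) ^ 2 * deriv L (-2 * ε (x 0) (x 1) ^ 2) * ![1, 1, 0, 0] a) := by
  rw [energyMomentum, fieldInvariant_radialField hF]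
  fin_cases a <;> fin_cases b <;>
    simp [hF, radialField, kronecker, Fin.sum_univ_four]
  all_goals ring

/-- The Einstein equations with a radial field, in trace-reversed form. -/
theorem einsteinNE_iff_ricciMixed (L : ℝ → ℝ) (Λ : ℝ)
    (hF : ∀ a b, raised g (radialField ε) a b x = -radialField ε x a b) :
    (∀ a b, einsteinMixed g a b x = energyMomentum L g (radialField ε) a b x - Λ * kronecker a b) ↔
      ∀ a b, ricciMixed g a b x = kronecker a b * (Λ - L (-2 * ε (x 0) (x 1) ^ 2) / 2
        - 2 * ε (x 0) (x 1) ^ 2 * deriv L (-2 * ε (x 0) (x 1) ^ 2) * ![0, 0, 1, 1] a) := by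
  -- Trace reversal moves the term `2E² L_F` from the `(0, 1)` block to the `(2, 3)` block and
  -- changes its sign.
  have key : ∀ a b, energyMomentum L g (radialField ε) a b x + kronecker a b *
      (Λ - (∑ c, energyMomentum L g (radialField ε) c c x) / 2)
      = kronecker a b * (Λ - L (-2 * ε (x 0) (x 1) ^ 2) / 2
        - 2 * ε (x 0) (x 1) ^ 2 * deriv L (-2 * ε (x 0) (x 1) ^ 2) * ![0, 0, 1, 1] a) := by
    intro a b
    simp only [energyMomentum_radialField L hF]
    have hk : ∀ c, kronecker c c = 1 := fun c => by simp [kronecker]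
    simp only [Fin.sum_univ_four, hk]
    fin_cases a <;> simp <;> ring
  constructor
  · intro h a b
    rw [ricciMixed_eq_of_einsteinMixed_eq h, key]
  · intro h
    apply einsteinMixed_eq_of_ricciMixed_eq
    intro a b
    rw [h, key]

end FieldTensors

/-! The field equations of a static spherically symmetric solution. -/

theorem staticMetric_raised_radialField {N s : (Fin 4 → ℝ) → ℝ} {ε : ℝ → ℝ → ℝ} {x : Fin 4 → ℝ}
    (hN : N x ≠ 0) (hr : x 1 ≠ 0) (hs : s x ≠ 0) (a b : Fin 4) :
    raised (staticMetric N s) (radialField ε) a b x = -radialField ε x a b := by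
  apply raised_radialField (α := -(N x)⁻¹) (β := 0) (δ := N x) (A := (x 1 ^ 2)⁻¹)
    (B := (x 1 ^ 2 * s x ^ 2)⁻¹)
  · rw [staticMetric_inv hN hr hs]
    ext a b
    fin_cases a <;> fin_cases b <;> simp
  · field_simp
    ring

theorem sssMetric_eq (Λ : ℝ) (f : ℝ → ℝ) : sssMetric Λ f =
    staticMetric (fun x => lapse Λ f (x 1)) (fun x => Real.sin (x 2)) := rfl

/-- These are the `tt` and `θθ` Ricci equations and the `t` component of Maxwell's equation. The
term `-(Λ/3) r²` of the lapse absorbs `Λ`, and its constant `1` cancels the curvature of the unit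
sphere. -/
theorem sss_field_equations_of_lapse_ne {Λ : ℝ} {L : ℝ → ℝ} {D R : Set ℝ} {f E : ℝ → ℝ}
    (hR : IsOpen R) (hpos : ∀ r ∈ R, 0 < r) (hf : ContDiffOn ℝ ∞ f R)
    (hsol : IsSSSSolution Λ L D R f E) {r : ℝ} (hr : r ∈ R) (hN : lapse Λ f r ≠ 0) :
    deriv (deriv f) r / 2 + deriv f r / r = L (-2 * E r ^ 2) / 2 ∧
    deriv f r / r + f r / r ^ 2
      = L (-2 * E r ^ 2) / 2 + 2 * E r ^ 2 * deriv L (-2 * E r ^ 2) ∧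
    deriv (fun ρ => ρ ^ 2 * deriv L (-2 * E ρ ^ 2) * E ρ) r = 0 := by
  obtain ⟨-, hsol⟩ := hsol
  set N : (Fin 4 → ℝ) → ℝ := fun x => lapse Λ f (x 1) with hNdef
  set s : (Fin 4 → ℝ) → ℝ := fun x => Real.sin (x 2) with hsdef
  -- A point on the equator, where `sin θ = 1` and its second derivative is `-1`.
  set x : Fin 4 → ℝ := ![0, r, Real.pi / 2, 0] with hxdef
  have hΩ : x ∈ sssDomain Λ f R := by
    refine ⟨hr, hN, ?_, ?_⟩ <;> simp [hxdef] <;> linarith [Real.pi_pos]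
  have hfr : ∀ ρ ∈ R, ContDiffAt ℝ ∞ f ρ := fun ρ hρ => hf.contDiffAt (hR.mem_nhds hρ)
  have hlapse : ∀ ρ ∈ R, ContDiffAt ℝ ∞ (lapse Λ f) ρ := fun ρ hρ => by
    unfold lapse
    exact (contDiffAt_const.sub (contDiffAt_const.mul (contDiffAt_id.pow 2))).add (hfr ρ hρ)
  have hpair : ∀ y ∈ sssDomain Λ f R, IsStaticPair N s y := by
    rintro y ⟨h1, h2, h3, h4⟩
    refine ⟨(hpos _ h1).ne', h2, (Real.sin_pos_of_pos_of_lt_pi h3 h4).ne', ?_, ?_, ?_, ?_⟩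
    · exact (hlapse _ h1).comp y contDiffAt_coord
    · exact Real.contDiff_sin.contDiffAt.comp y contDiffAt_coord
    · exact fun i hi => pd_comp_coord_of_ne hi
    · exact fun i hi => pd_comp_coord_of_ne hi
  have hev : ∀ᶠ y in 𝓝 x, y ∈ sssDomain Λ f R := hsol.isOpen_domain.mem_nhds hΩ
  have hF : ∀ y ∈ sssDomain Λ f R, ∀ a b, raised (staticMetric N s) (radialField fun _ r => E r) a b y
      = -radialField (fun _ r => E r) y a b := fun y hy a b =>
    staticMetric_raised_radialField (hpair y hy).lapse_ne (hpair y hy).coord_ne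
      (hpair y hy).polar_ne a b
  have hx1 : x 1 = r := by simp [hxdef]
  have hr0 : r ≠ 0 := (hpos r hr).ne'
  have hsx : s x = 1 := by simp [hsdef, hxdef]
  have hNx : N x = lapse Λ f r := rfl
  have hpN : pd 1 N = fun y => deriv (lapse Λ f) (y 1) := by
    funext y; exact pd_comp_coord
  have hppN : pd 1 (pd 1 N) x = deriv (deriv (lapse Λ f)) r := by
    rw [hpN]; exact pd_comp_coord
  have hps : pd 2 s = fun y => Real.cos (y 2) := by
    funext y; rw [hsdef, pd_comp_coord, Real.deriv_sin]
  have hpps : pd 2 (pd 2 s) x = -1 := by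
    rw [hps, pd_comp_coord, Real.deriv_cos]; simp [hxdef]
  have hdl : ∀ ρ ∈ R, deriv (lapse Λ f) ρ = -(2 * Λ / 3 * ρ) + deriv f ρ := fun ρ hρ => by
    have h1 : HasDerivAt (lapse Λ f) (0 - Λ / 3 * (2 * ρ ^ (2 - 1) * 1) + deriv f ρ) ρ := by
      apply HasDerivAt.add _ ((hfr ρ hρ).differentiableAt (by simp)).hasDerivAt
      exact (hasDerivAt_const ρ 1).sub (((hasDerivAt_id ρ).pow 2).const_mul _)
    rw [h1.deriv]; ring
  have hddl : deriv (deriv (lapse Λ f)) r = -(2 * Λ / 3) + deriv (deriv f) r := by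
    have h1 : deriv (lapse Λ f) =ᶠ[𝓝 r] fun ρ => -(2 * Λ / 3 * ρ) + deriv f ρ := by
      filter_upwards [hR.mem_nhds hr] with ρ hρ using hdl ρ hρ
    rw [h1.deriv_eq]
    have h2 : DifferentiableAt ℝ (deriv f) r :=
      ((hf.deriv_of_isOpen (m := ∞) hR (by simp)).contDiffAt (hR.mem_nhds hr)).differentiableAt
        (by simp)
    have h3 := (((hasDerivAt_id r).const_mul (2 * Λ / 3)).neg).add h2.hasDerivAt
    exact h3.deriv.trans (by ring)
  have hric := (einsteinNE_iff_ricciMixed L Λ (hF x hΩ)).1 (hsol.einstein_eq x hΩ)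
  obtain ⟨h00, h22⟩ := ricci_staticMetric (hev.mono hpair)
  have hdiag : ∀ a, ricciMixed (staticMetric N s) a a x
      = ![-(N x)⁻¹, N x, (x 1 ^ 2)⁻¹, (x 1 ^ 2 * s x ^ 2)⁻¹] a
        * ricci (staticMetric N s) a a x := by
    intro a
    rw [ricciMixed, staticMetric_inv (hpair x hΩ).lapse_ne (hpair x hΩ).coord_ne
      (hpair x hΩ).polar_ne, Finset.sum_eq_single a]
    · rw [Matrix.diagonal_apply_eq]
    · intro b _ hb
      rw [Matrix.diagonal_apply_ne _ hb.symm, zero_mul]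
    · simp
  have e0 := hric 0 0
  have e2 := hric 2 2
  rw [hdiag, h00, hppN, hddl, hpN] at e0
  rw [hdiag, h22, hpps, hpN] at e2
  simp only [hx1, hsx, hNx, hdl r hr, kronecker, if_true] at e0 e2
  simp at e0 e2
  refine ⟨?_, ?_, ?_⟩
  · field_simp at e0 ⊢
    linear_combination -e0 / 3
  · rw [lapse] at e2
    field_simp at e2 ⊢
    linear_combination -e2 / 3
  · have hM := hsol.maxwell_eq x hΩ 0
    have hterm : ∀ a, pd a (fun y => Real.sqrt (-(sssMetric Λ f y).det)
        * deriv L (fieldInvariant (sssMetric Λ f) (radialField fun _ r => E r) y)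
        * raised (sssMetric Λ f) (radialField fun _ r => E r) a 0 y) x
        = pd a (fun y => (y 1 ^ 2 * deriv L (-2 * E (y 1) ^ 2) * ![0, E (y 1), 0, 0] a) * s y) x := by
      intro a
      apply pd_congr
      filter_upwards [hev] with y hy
      have hsy : 0 < s y := Real.sin_pos_of_pos_of_lt_pi hy.2.2.1 hy.2.2.2
      rw [sssMetric_eq, fieldInvariant_radialField (hF y hy), hF y hy,
        staticMetric_det (hpair y hy).lapse_ne, neg_neg, Real.sqrt_sq (by positivity)]
      fin_cases a <;> simp [radialField]
      ring
    simp only [hterm] at hM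
    rw [Fin.sum_univ_four] at hM
    have h1 : pd 1 (fun y => (y 1 ^ 2 * deriv L (-2 * E (y 1) ^ 2) * ![0, E (y 1), 0, 0] 1) * s y) x
        = deriv (fun ρ => ρ ^ 2 * deriv L (-2 * E ρ ^ 2) * E ρ) r := by
      have h2 : ∀ t, s (Function.update x 1 t) = 1 := fun t => by simp [hsdef, hxdef]
      simp only [pd, h2, mul_one, hx1]
      simp
    rw [h1] at hM
    simpa [pd_const] using hM

/-- The field equations of a static spherically symmetric solution hold across the horizons. -/
theorem sss_field_equations {Λ : ℝ} {L : ℝ → ℝ} {D R : Set ℝ} {f E : ℝ → ℝ}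
    (hD : IsOpen D) (hL : ContDiffOn ℝ ∞ L D)
    (hR : IsOpen R) (hpos : ∀ r ∈ R, 0 < r) (hf : ContDiffOn ℝ ∞ f R) (hE : ContDiffOn ℝ ∞ E R)
    (hED : ∀ r ∈ R, -2 * E r ^ 2 ∈ D)
    (hsol : IsSSSSolution Λ L D R f E) {r : ℝ} (hr : r ∈ R) :
    deriv (deriv f) r / 2 + deriv f r / r = L (-2 * E r ^ 2) / 2 ∧
    deriv f r / r + f r / r ^ 2
      = L (-2 * E r ^ 2) / 2 + 2 * E r ^ 2 * deriv L (-2 * E r ^ 2) ∧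
    deriv (fun ρ => ρ ^ 2 * deriv L (-2 * E ρ ^ 2) * E ρ) r = 0 := by
  -- Continuous functions that agree off the horizons agree at `r`, because `r` is a limit of such
  -- radii.
  have key : ∀ φ ψ : ℝ → ℝ, ContinuousOn φ R → ContinuousOn ψ R →
      (∀ ρ ∈ R, lapse Λ f ρ ≠ 0 → φ ρ = ψ ρ) → φ r = ψ r := by
    intro φ ψ hφ hψ h
    have hcl := hsol.1 hr
    have : (𝓝[{ρ ∈ R | lapse Λ f ρ ≠ 0}] r).NeBot := mem_closure_iff_nhdsWithin_neBot.1 hcl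
    have hsub : {ρ ∈ R | lapse Λ f ρ ≠ 0} ⊆ R := fun ρ hρ => hρ.1
    refine tendsto_nhds_unique ((hφ r hr).mono_left (nhdsWithin_mono r hsub))
      (((hψ r hr).mono_left (nhdsWithin_mono r hsub)).congr' ?_)
    filter_upwards [self_mem_nhdsWithin] with ρ hρ using (h ρ hρ.1 hρ.2).symm
  have hinv : ContDiffOn ℝ ∞ (fun ρ => -2 * E ρ ^ 2) R := contDiffOn_const.mul (hE.pow 2)
  have hLc : ContDiffOn ℝ ∞ (fun ρ => L (-2 * E ρ ^ 2)) R := hL.comp hinv hED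
  have hL'c : ContDiffOn ℝ ∞ (fun ρ => deriv L (-2 * E ρ ^ 2)) R :=
    (hL.deriv_of_isOpen (m := ∞) hD (by simp)).comp hinv hED
  have hf' : ContDiffOn ℝ ∞ (deriv f) R := hf.deriv_of_isOpen hR (by simp)
  have hf'' : ContDiffOn ℝ ∞ (deriv (deriv f)) R := hf'.deriv_of_isOpen hR (by simp)
  have hq : ContDiffOn ℝ ∞ (deriv fun ρ => ρ ^ 2 * deriv L (-2 * E ρ ^ 2) * E ρ) R :=
    (((contDiffOn_id.pow 2).mul hL'c).mul hE).deriv_of_isOpen hR (by simp)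
  have hid : ∀ ρ ∈ R, ρ ≠ 0 := fun ρ hρ => (hpos ρ hρ).ne'
  refine ⟨key _ _ ?_ ?_ fun ρ hρ hN =>
      (sss_field_equations_of_lapse_ne hR hpos hf hsol hρ hN).1,
    key _ _ ?_ ?_ fun ρ hρ hN =>
      (sss_field_equations_of_lapse_ne hR hpos hf hsol hρ hN).2.1,
    key _ _ ?_ ?_ fun ρ hρ hN =>
      (sss_field_equations_of_lapse_ne hR hpos hf hsol hρ hN).2.2⟩
  · exact (hf''.continuousOn.div_const _).add (hf'.continuousOn.div continuousOn_id hid)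
  · exact hLc.continuousOn.div_const _
  · exact (hf'.continuousOn.div continuousOn_id hid).add
      (hf.continuousOn.div (continuousOn_id.pow 2) fun ρ hρ => pow_ne_zero 2 (hid ρ hρ))
  · exact (hLc.continuousOn.div_const _).add
      ((continuousOn_const.mul (hE.continuousOn.pow 2)).mul hL'c.continuousOn)
  · exact hq.continuousOn
  · exact continuousOn_const

/-! ### Ricci tensor of the modified Robinson–Trautman metric -/

theorem pd_comm_three {f : (Fin 4 → ℝ) → ℝ} {x : Fin 4 → ℝ} {i j : Fin 4}
    (h : ∀ᶠ y in 𝓝 x, ContDiffAt ℝ ∞ f y) :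
    pd i (pd j (pd j f)) x = pd j (pd j (pd i f)) x := by
  rw [pd_comm h.self_of_nhds.pd]
  exact pd_congr (h.mono fun y hy => pd_comm hy)

/-- Regularity of the coefficient functions of a Robinson--Trautman metric modified by a radial
function `Q`; here `p` stands for `ln P`. -/
structure IsRTData (P p M K Q : (Fin 4 → ℝ) → ℝ) (y : Fin 4 → ℝ) : Prop where
  coord_ne : y 1 ≠ 0
  conformal_ne : P y ≠ 0
  smooth_P : ContDiffAt ℝ ∞ P y
  smooth_p : ContDiffAt ℝ ∞ p y
  smooth_M : ContDiffAt ℝ ∞ M y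
  smooth_K : ContDiffAt ℝ ∞ K y
  smooth_Q : ContDiffAt ℝ ∞ Q y
  pd_P : ∀ i, pd i P y = pd i p y * P y
  pd_p : pd 1 p y = 0
  pd_M : ∀ i, i ≠ 0 → pd i M y = 0
  pd_K : pd 1 K y = 0
  pd_Q_two : pd 2 Q y = 0
  pd_Q_three : pd 3 Q y = 0
  curvature : K y = P y ^ 2 * (pd 2 (pd 2 p) y + pd 3 (pd 3 p) y)

section RobinsonTrautman

variable {P p M K Q : (Fin 4 → ℝ) → ℝ} {x : Fin 4 → ℝ}

/-- The function `2H + Q` in terms of `p = ln P` and `K = Δ ln P`. -/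
noncomputable def rtPotential (Λ : ℝ) (p M K Q : (Fin 4 → ℝ) → ℝ) (y : Fin 4 → ℝ) : ℝ :=
  K y - 2 * y 1 * pd 0 p y - 2 * M y / y 1 - Λ / 3 * y 1 ^ 2 + Q y

/-- The logarithmic differential of `r²/P²` is `2 dr/r - 2 dp`. -/
theorem IsRTData.isConformalFactor (hx : IsRTData P p M K Q x) :
    IsConformalFactor p (fun y => y 1 ^ 2 / P y ^ 2) x := by
  obtain ⟨hr, hP, sP, sp, sM, sK, sQ, hdP, hp, hM, hK, hQ2, hQ3, hKc⟩ := hx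
  have sr2 : ContDiffAt ℝ ∞ (fun y : Fin 4 → ℝ => y 1 ^ 2) x := contDiffAt_coord.pow 2
  have sP2 : ContDiffAt ℝ ∞ (fun y => P y ^ 2) x := sP.pow 2
  have key : ∀ i, pd i (fun y => y 1 ^ 2 / P y ^ 2) x
      = ((if i = 1 then 2 / x 1 else 0) - 2 * pd i p x) * (x 1 ^ 2 / P x ^ 2) := by
    intro i
    rw [pd_div sr2 sP2 (pow_ne_zero 2 hP), pd_pow contDiffAt_coord, pd_pow sP, pd_coord, hdP]
    split_ifs <;> field_simp <;> ring
  refine ⟨hr, by positivity, ?_, ?_, ?_, ?_⟩ <;> rw [key] <;> simp [hp]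

theorem IsRTData.contDiffAt_rtPotential (hx : IsRTData P p M K Q x) (Λ : ℝ) :
    ContDiffAt ℝ ∞ (rtPotential Λ p M K Q) x := by
  have sr : ContDiffAt ℝ ∞ (fun y : Fin 4 → ℝ => y 1) x := contDiffAt_coord
  exact (((hx.smooth_K.sub ((contDiffAt_const.mul sr).mul hx.smooth_p.pd)).sub
    ((contDiffAt_const.mul hx.smooth_M).div sr hx.coord_ne)).sub
    (contDiffAt_const.mul (sr.pow 2))).add hx.smooth_Q

theorem IsRTData.pd_rtPotential (hx : IsRTData P p M K Q x) (Λ : ℝ) (i : Fin 4) :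
    pd i (rtPotential Λ p M K Q) x = pd i K x - 2 * x 1 * pd i (pd 0 p) x - 2 * pd i M x / x 1
      + pd i Q x + (if i = 1 then -2 * pd 0 p x + 2 * M x / x 1 ^ 2 - 2 * Λ / 3 * x 1 else 0) := by
  have sr : ContDiffAt ℝ ∞ (fun y : Fin 4 → ℝ => y 1) x := contDiffAt_coord
  have s1 : ContDiffAt ℝ ∞ (fun y : Fin 4 → ℝ => 2 * y 1) x := contDiffAt_const.mul sr
  have s2 := s1.mul (hx.smooth_p.pd (i := 0))
  have s3 : ContDiffAt ℝ ∞ (fun y => 2 * M y) x := contDiffAt_const.mul hx.smooth_M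
  have s4 : ContDiffAt ℝ ∞ (fun y => 2 * M y / y 1) x := s3.div sr hx.coord_ne
  have s5 : ContDiffAt ℝ ∞ (fun y : Fin 4 → ℝ => Λ / 3 * y 1 ^ 2) x :=
    contDiffAt_const.mul (sr.pow 2)
  have hr := hx.coord_ne
  unfold rtPotential
  rw [pd_add ((hx.smooth_K.sub s2).sub s4 |>.sub s5) hx.smooth_Q,
    pd_sub ((hx.smooth_K.sub s2).sub s4) s5, pd_sub (hx.smooth_K.sub s2) s4,
    pd_sub hx.smooth_K s2, pd_mul s1 hx.smooth_p.pd, pd_div s3 sr hr, pd_const_mul, pd_const_mul,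
    pd_const_mul, pd_pow sr, pd_coord]
  split_ifs <;> field_simp <;> ring

/-- The Ricci tensor of a Robinson--Trautman metric modified by a radial function `Q`. -/
theorem nullRicci_rtPotential (hx : ∀ᶠ y in 𝓝 x, IsRTData P p M K Q y) {Λ : ℝ}
    (hRT : P x ^ 2 * (pd 2 (pd 2 K) x + pd 3 (pd 3 K) x) + 12 * M x * pd 0 p x - 4 * pd 0 M x = 0)
    (hcon : pd 0 p x * (x 1 * pd 1 Q x - 2 * Q x) + pd 0 Q x = 0) :
    nullRicci (rtPotential Λ p M K Q) p (fun y => y 1 ^ 2 / P y ^ 2) x =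
      let A := Λ - (pd 1 (pd 1 Q) x / 2 + pd 1 Q x / x 1)
      let B := Λ - (pd 1 Q x / x 1 + Q x / x 1 ^ 2)
      !![-rtPotential Λ p M K Q x * A, -A, 0, 0;
        -A, 0, 0, 0;
        0, 0, x 1 ^ 2 / P x ^ 2 * B, 0;
        0, 0, 0, x 1 ^ 2 / P x ^ 2 * B] := by
  have hd := hx.self_of_nhds
  have hpe : ∀ᶠ y in 𝓝 x, ContDiffAt ℝ ∞ p y := hx.mono fun y hy => hy.smooth_p
  obtain ⟨hr, hP, sP, sp, sM, sK, sQ, hdP, hp, hM, hK, hQ2, hQ3, hKc⟩ := hd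
  have sr : ContDiffAt ℝ ∞ (fun y : Fin 4 → ℝ => y 1) x := contDiffAt_coord
  have sP2 : ContDiffAt ℝ ∞ (fun y => P y ^ 2) x := sP.pow 2
  have hp1 : ∀ i, pd i (pd 1 p) x = 0 := fun i => by
    rw [pd_congr (g := fun _ => 0) (hx.mono fun y hy => hy.pd_p), pd_const]
  have h1p : pd 1 (pd 0 p) x = 0 := by rw [pd_comm sp, hp1]
  have hK1 : ∀ i, pd i (pd 1 K) x = 0 := fun i => by
    rw [pd_congr (g := fun _ => 0) (hx.mono fun y hy => hy.pd_K), pd_const]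
  have hh := fun i => (hx.self_of_nhds).pd_rtPotential Λ i
  have h0 := hh 0
  have h1 := hh 1
  -- First derivatives of the potential are recorded as germs because they are differentiated again.
  -- The transverse ones lose `M` and `Q`, which do not depend on `x, y`.
  have h2e : pd 2 (rtPotential Λ p M K Q) =ᶠ[𝓝 x]
      fun y => pd 2 K y - 2 * y 1 * pd 2 (pd 0 p) y := hx.mono fun y hy => by
    simp [hy.pd_rtPotential, hy.pd_M, hy.pd_Q_two]
  have h3e : pd 3 (rtPotential Λ p M K Q) =ᶠ[𝓝 x]
      fun y => pd 3 K y - 2 * y 1 * pd 3 (pd 0 p) y := hx.mono fun y hy => by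
    simp [hy.pd_rtPotential, hy.pd_M, hy.pd_Q_three]
  have hp01 : ∀ᶠ y in 𝓝 x, pd 1 (pd 0 p) y = 0 := by
    filter_upwards [hx.eventually_nhds] with y hy
    rw [pd_comm hy.self_of_nhds.smooth_p,
      pd_congr (g := fun _ => 0) (hy.mono fun z hz => hz.pd_p), pd_const]
  have h1e : pd 1 (rtPotential Λ p M K Q) =ᶠ[𝓝 x]
      fun y => pd 1 Q y - 2 * pd 0 p y + 2 * M y / y 1 ^ 2 - 2 * Λ / 3 * y 1 := by
    filter_upwards [hx, hp01] with y hy hpy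
    simp only [hy.pd_rtPotential, hy.pd_K, hpy]
    simp [hy.pd_M]
    ring
  have s2r : ContDiffAt ℝ ∞ (fun y : Fin 4 → ℝ => 2 * y 1) x := contDiffAt_const.mul sr
  have sr2 : ContDiffAt ℝ ∞ (fun y : Fin 4 → ℝ => y 1 ^ 2) x := sr.pow 2
  have s2M : ContDiffAt ℝ ∞ (fun y => 2 * M y) x := contDiffAt_const.mul sM
  have sMr : ContDiffAt ℝ ∞ (fun y => 2 * M y / y 1 ^ 2) x := s2M.div sr2 (pow_ne_zero 2 hr)
  have hside : ∀ j i, pd i (fun y => pd j K y - 2 * y 1 * pd j (pd 0 p) y) x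
      = pd i (pd j K) x - 2 * x 1 * pd i (pd j (pd 0 p)) x
        - (if i = 1 then 2 * pd j (pd 0 p) x else 0) := fun j i => by
    rw [pd_sub sK.pd (s2r.mul sp.pd.pd), pd_mul s2r sp.pd.pd, pd_const_mul, pd_coord]
    split_ifs <;> ring
  have h22 := (pd_congr (i := 2) h2e).trans (hside 2 2)
  have h33 := (pd_congr (i := 3) h3e).trans (hside 3 3)
  have hK12 : ∀ j, pd 1 (pd j K) x = 0 := fun j => by rw [pd_comm sK, hK1]
  have hp12 : ∀ j, pd 1 (pd j (pd 0 p)) x = 0 := fun j => by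
    rw [pd_comm sp.pd, pd_congr (g := fun _ => 0) hp01, pd_const]
  have h12 := (pd_congr (i := 1) h2e).trans (hside 2 1)
  have h13 := (pd_congr (i := 1) h3e).trans (hside 3 1)
  rw [hK12, hp12, if_pos rfl] at h12 h13
  rw [if_neg (by decide)] at h22 h33
  have h11 : pd 1 (pd 1 (rtPotential Λ p M K Q)) x
      = pd 1 (pd 1 Q) x - 4 * M x / x 1 ^ 3 - 2 * Λ / 3 := by
    rw [pd_congr h1e, pd_sub ((sQ.pd.sub (contDiffAt_const.mul sp.pd)).add
        sMr) (contDiffAt_const.mul sr),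
      pd_add (sQ.pd.sub (contDiffAt_const.mul sp.pd)) sMr,
      pd_sub sQ.pd (contDiffAt_const.mul sp.pd), pd_const_mul, pd_const_mul,
      pd_div s2M sr2 (pow_ne_zero 2 hr), pd_const_mul, pd_pow sr, pd_coord, h1p,
      hM 1 (by decide), if_pos rfl]
    field_simp
    ring
  -- `K_{,u} = 2 p_{,u} K + Δ p_{,u}`; the last term cancels the one that `-2r p_{,u}` contributes
  -- to the transverse Laplacian of the potential.
  have hK0 : pd 0 K x = 2 * pd 0 p x * K x
      + P x ^ 2 * (pd 2 (pd 2 (pd 0 p)) x + pd 3 (pd 3 (pd 0 p)) x) := by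
    rw [pd_congr (hx.mono fun y hy => hy.curvature),
      pd_mul sP2 (sp.pd.pd.add sp.pd.pd), pd_add sp.pd.pd sp.pd.pd, pd_pow sP, hdP,
      pd_comm_three hpe, pd_comm_three hpe, hKc]
    push_cast
    ring
  rw [if_neg (by decide), hK0] at h0
  rw [if_pos rfl, hK, hM 1 (by decide), h1p] at h1
  have p20 := pd_comm (i := 2) (j := 0) sp
  have p30 := pd_comm (i := 3) (j := 0) sp
  have hur : pd 1 (pd 1 (rtPotential Λ p M K Q)) x / 2 + pd 1 (rtPotential Λ p M K Q) x / x 1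
      + 2 * pd 0 p x / x 1 = -(Λ - (pd 1 (pd 1 Q) x / 2 + pd 1 Q x / x 1)) := by
    rw [h11, h1]
    field_simp
    ring
  have hxx : pd 2 (pd 2 p) x + pd 3 (pd 3 p) x - x 1 ^ 2 / P x ^ 2 *
      (rtPotential Λ p M K Q x + x 1 * pd 1 (rtPotential Λ p M K Q) x + 4 * pd 0 p x * x 1)
        / x 1 ^ 2 = x 1 ^ 2 / P x ^ 2 * (Λ - (pd 1 Q x / x 1 + Q x / x 1 ^ 2)) := by
    have : pd 2 (pd 2 p) x + pd 3 (pd 3 p) x = K x / P x ^ 2 := by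
      rw [hKc]; field_simp
    rw [this, h1, rtPotential]
    field_simp
    ring
  -- The `uu` component minus the potential times the `ur` component.
  have huu : (pd 2 (pd 2 (rtPotential Λ p M K Q)) x + pd 3 (pd 3 (rtPotential Λ p M K Q)) x)
        / (x 1 ^ 2 / P x ^ 2) / 2 + 2 * pd 0 (pd 0 p) x
      + pd 0 p x * pd 1 (rtPotential Λ p M K Q) x + pd 0 (rtPotential Λ p M K Q) x / x 1
      - 2 * pd 0 p x ^ 2 - 2 * rtPotential Λ p M K Q x * pd 0 p x / x 1 = 0 := by
    rw [h22, h33, h0, h1, rtPotential]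
    field_simp
    -- The left side is the Robinson–Trautman expression over `2r²` plus the constraint over `r`;
    -- the coefficients reflect the common denominator `6r²`.
    linear_combination 3 * hRT + 6 * x 1 * hcon
  ext a b
  fin_cases a <;> fin_cases b <;> simp only [nullRicci] <;> simp
  · linear_combination huu + rtPotential Λ p M K Q x * hur
  · linear_combination hur
  · linear_combination h12 / 2 - p20
  · linear_combination h13 / 2 - p30
  · linear_combination hur
  · linear_combination h12 / 2 - p20
  · linear_combination hxx
  · linear_combination h13 / 2 - p30
  · linear_combination hxx

end RobinsonTrautman

/-! ### Evolution of the charge in `u` -/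

/-- The charge `q = r² L_F E` of a family of static solutions whose parameters depend on `u`
satisfies `q_{,u} = 2 (ln P)_{,u} q` where `E` does not vanish. -/
theorem pd_charge_mul_field {L : ℝ → ℝ} {p Q E q : (Fin 4 → ℝ) → ℝ} {x : Fin 4 → ℝ}
    (hr : x 1 ≠ 0) (sp : ∀ᶠ y in 𝓝 x, ContDiffAt ℝ ∞ p y) (sQ : ∀ᶠ y in 𝓝 x, ContDiffAt ℝ ∞ Q y)
    (sE : ContDiffAt ℝ ∞ E x) (sq : ContDiffAt ℝ ∞ q x)
    (hL : DifferentiableAt ℝ L (-2 * E x ^ 2))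
    (hq : q =ᶠ[𝓝 x] fun y => y 1 ^ 2 * deriv L (-2 * E y ^ 2) * E y)
    (hp1 : ∀ᶠ y in 𝓝 x, pd 1 p y = 0)
    (hA : ∀ᶠ y in 𝓝 x, pd 1 (pd 1 Q) y / 2 + pd 1 Q y / y 1 = L (-2 * E y ^ 2) / 2)
    (hB : ∀ᶠ y in 𝓝 x, y 1 ≠ 0 ∧ pd 1 Q y / y 1 + Q y / y 1 ^ 2
      = L (-2 * E y ^ 2) / 2 + 2 * E y ^ 2 * deriv L (-2 * E y ^ 2))
    (hcon : ∀ᶠ y in 𝓝 x, pd 0 p y * (y 1 * pd 1 Q y - 2 * Q y) + pd 0 Q y = 0) :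
    (pd 0 q x - 2 * pd 0 p x * q x) * E x = 0 := by
  have sr : ContDiffAt ℝ ∞ (fun y : Fin 4 → ℝ => y 1) x := contDiffAt_coord
  have sr2 : ContDiffAt ℝ ∞ (fun y : Fin 4 → ℝ => y 1 ^ 2) x := sr.pow 2
  have sQx := sQ.self_of_nhds
  have h10p : ∀ᶠ y in 𝓝 x, pd 1 (pd 0 p) y = 0 := by
    filter_upwards [sp, hp1.eventually_nhds] with y hy hy1
    rw [pd_comm hy, pd_congr (g := fun _ => 0) hy1, pd_const]
  -- This is `r²` times the difference of `hB` and `hA`; `L` drops out.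
  have hS : (fun y => Q y - y 1 ^ 2 * pd 1 (pd 1 Q) y / 2) =ᶠ[𝓝 x] fun y => 2 * (q y * E y) := by
    filter_upwards [hA, hB, hq] with y hAy hBy hqy
    obtain ⟨hy, hBy⟩ := hBy
    rw [hqy]
    field_simp at hAy hBy ⊢
    linear_combination hBy - y 1 * hAy
  have hSpd : pd 0 Q x - x 1 ^ 2 * pd 0 (pd 1 (pd 1 Q)) x / 2
      = 2 * (pd 0 q x * E x + q x * pd 0 E x) := by
    have h := pd_congr (i := 0) hS
    rw [pd_const_mul, pd_mul sq sE, pd_sub sQx ((sr2.mul sQx.pd.pd).div_const 2), pd_div_const,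
      pd_mul sr2 sQx.pd.pd, pd_pow sr, pd_coord, if_neg (by decide)] at h
    rw [← h]
    ring
  have sE2 : ContDiffAt ℝ ∞ (fun y => -2 * E y ^ 2) x := contDiffAt_const.mul (sE.pow 2)
  have sQr : ContDiffAt ℝ ∞ (fun y => pd 1 Q y / y 1) x := sQx.pd.div sr hr
  have hqx := hq.self_of_nhds
  -- The `u`-derivative of `hA`: the chain rule produces `L_F E E_{,u}`, and `L_F E = q/r²`.
  have hApd : pd 0 (pd 1 (pd 1 Q)) x / 2 + pd 0 (pd 1 Q) x / x 1
      = -2 * q x * pd 0 E x / x 1 ^ 2 := by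
    have h := pd_congr (i := 0) hA
    rw [pd_div_const, pd_comp hL sE2, pd_const_mul, pd_pow sE, pd_add (sQx.pd.pd.div_const 2) sQr,
      pd_div_const, pd_div sQx.pd sr hr, pd_coord, if_neg (by decide)] at h
    have h2 : q x / x 1 ^ 2 = deriv L (-2 * E x ^ 2) * E x := by
      rw [hqx]; field_simp
    have h3 : -2 * q x * pd 0 E x / x 1 ^ 2 = -2 * (q x / x 1 ^ 2) * pd 0 E x := by ring
    rw [h3, h2]
    push_cast at h
    simp only [mul_zero, sub_zero] at h ⊢
    field_simp at h ⊢
    linear_combination h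
  have hC : ∀ᶠ y in 𝓝 x, pd 0 Q y = pd 0 p y * (2 * Q y - y 1 * pd 1 Q y) := by
    filter_upwards [hcon] with y hy
    linear_combination hy
  -- Since `p_{,u}` does not depend on `r`, differentiating the constraint twice in `r` expresses
  -- `Q_{,ru}` and `Q_{,rru}` by `r`-derivatives of `Q`.
  have hC1 : ∀ᶠ y in 𝓝 x, pd 1 (pd 0 Q) y = pd 0 p y * (pd 1 Q y - y 1 * pd 1 (pd 1 Q) y) := by
    filter_upwards [hC.eventually_nhds, h10p, sp, sQ] with y hy hpy spy sQy
    have s1 : ContDiffAt ℝ ∞ (fun z : Fin 4 → ℝ => z 1) y := contDiffAt_coord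
    have s2 : ContDiffAt ℝ ∞ (fun z => 2 * Q z) y := contDiffAt_const.mul sQy
    rw [pd_congr hy, pd_mul spy.pd (s2.sub (s1.mul sQy.pd)), pd_sub s2 (s1.mul sQy.pd),
      pd_const_mul, pd_mul s1 sQy.pd, pd_coord, hpy, if_pos rfl]
    ring
  have hC11 : pd 1 (pd 1 (pd 0 Q)) x = -(pd 0 p x * x 1 * pd 1 (pd 1 (pd 1 Q)) x) := by
    rw [pd_congr hC1, pd_mul sp.self_of_nhds.pd (sQx.pd.sub (sr.mul sQx.pd.pd)),
      pd_sub sQx.pd (sr.mul sQx.pd.pd), pd_mul sr sQx.pd.pd, pd_coord, h10p.self_of_nhds,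
      if_pos rfl]
    ring
  have b := hS.self_of_nhds
  simp only at b
  rw [pd_comm_three sQ, hC11, hC.self_of_nhds] at hSpd
  rw [pd_comm_three sQ, hC11, pd_comm sQx, hC1.self_of_nhds] at hApd
  have a0' : pd 0 p x * (x 1 * pd 1 Q x - x 1 ^ 2 * pd 1 (pd 1 Q) x
      - x 1 ^ 3 * pd 1 (pd 1 (pd 1 Q)) x / 2) = -2 * q x * pd 0 E x := by
    field_simp at hApd ⊢
    linear_combination hApd
  -- Adding the two `u`-derivatives removes `q E_{,u}` and the third `r`-derivative of `Q`; the
  -- remainder is `p_{,u} (Q - r² Q_{,rr}/2) = 2 p_{,u} q E`.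
  linear_combination -hSpd / 2 + pd 0 p x * b - a0' / 2

/-! Fields that depend on some of the coordinates only, as functions on coordinate space. -/

section Lift

/-- A function of `(u, x, y)` on coordinate space. -/
def liftTransverse (F : ℝ → ℝ → ℝ → ℝ) (z : Fin 4 → ℝ) : ℝ := F (z 0) (z 2) (z 3)

/-- A function of `(u, r)` on coordinate space. -/
def liftRadial (F : ℝ → ℝ → ℝ) (z : Fin 4 → ℝ) : ℝ := F (z 0) (z 1)

theorem pd_one_liftTransverse (F : ℝ → ℝ → ℝ → ℝ) (z : Fin 4 → ℝ) :
    pd 1 (liftTransverse F) z = 0 := by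
  simp [pd, liftTransverse]

theorem pd_zero_liftTransverse (F : ℝ → ℝ → ℝ → ℝ) (z : Fin 4 → ℝ) :
    pd 0 (liftTransverse F) z = deriv (fun s => F s (z 2) (z 3)) (z 0) := by
  simp [pd, liftTransverse]

theorem liftTransverse_rtLaplacian (P F : ℝ → ℝ → ℝ → ℝ) (z : Fin 4 → ℝ) :
    liftTransverse (rtLaplacian P F) z = liftTransverse P z ^ 2 *
      (pd 2 (pd 2 (liftTransverse F)) z + pd 3 (pd 3 (liftTransverse F)) z) := by
  simp [pd, liftTransverse, rtLaplacian]

theorem pd_two_liftRadial (F : ℝ → ℝ → ℝ) (z : Fin 4 → ℝ) : pd 2 (liftRadial F) z = 0 := by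
  simp [pd, liftRadial]

theorem pd_three_liftRadial (F : ℝ → ℝ → ℝ) (z : Fin 4 → ℝ) : pd 3 (liftRadial F) z = 0 := by
  simp [pd, liftRadial]

theorem pd_zero_liftRadial (F : ℝ → ℝ → ℝ) (z : Fin 4 → ℝ) :
    pd 0 (liftRadial F) z = deriv (fun s => F s (z 1)) (z 0) := by
  simp [pd, liftRadial]

theorem pd_one_liftRadial (F : ℝ → ℝ → ℝ) (z : Fin 4 → ℝ) :
    pd 1 (liftRadial F) z = deriv (fun s => F (z 0) s) (z 1) := by
  simp [pd, liftRadial]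

theorem pd_one_one_liftRadial (F : ℝ → ℝ → ℝ) (z : Fin 4 → ℝ) :
    pd 1 (pd 1 (liftRadial F)) z = deriv (deriv fun s => F (z 0) s) (z 1) := by
  simp [pd, liftRadial]

/-- The bridge from the explicit matrix to the null form in which the curvature was computed. -/
theorem rtModifiedMetric_eq (Λ : ℝ) (P : ℝ → ℝ → ℝ → ℝ) (m : ℝ → ℝ) (Q : ℝ → ℝ → ℝ) :
    rtModifiedMetric Λ P m Q =
      nullMetric (rtPotential Λ (liftTransverse (logP P)) (fun z => m (z 0))
        (liftTransverse (rtLaplacian P (logP P))) (liftRadial Q))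
        (fun z => z 1 ^ 2 / liftTransverse P z ^ 2) := by
  funext z
  ext a b
  have h := pd_zero_liftTransverse (logP P) z
  fin_cases a <;> fin_cases b <;>
    simp [rtModifiedMetric, rtMetric, nullMetric, liftTransverse, Matrix.single]
  rw [rtPotential, h]
  simp [twoH, liftTransverse, liftRadial, logPu]
  ring

end Lift

/-! ### Signature, closedness and the main theorem -/

theorem isLorentzian_nullMetric {h G : (Fin 4 → ℝ) → ℝ} {x : Fin 4 → ℝ} {k : ℝ} (hk : k ≠ 0)
    (hG : G x * k ^ 2 = 1) : IsLorentzian (nullMetric h G x) := by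
  -- The columns are an orthonormal frame: `∂_u + (1-h)/2 ∂_r` is unit timelike, `∂_u - (1+h)/2 ∂_r`
  -- unit spacelike, and `k² = 1/G` normalizes the transverse vectors.
  refine ⟨?_, !![1, 1, 0, 0; (1 - h x) / 2, -(1 + h x) / 2, 0, 0; 0, 0, k, 0; 0, 0, 0, k], ?_, ?_⟩
  · ext a b
    fin_cases a <;> fin_cases b <;> simp [nullMetric]
  · rw [isUnit_iff_ne_zero]
    simp [Matrix.det_succ_row_zero, Fin.sum_univ_succ, Fin.succAbove]
    intro h0
    exact mul_ne_zero hk hk (by linear_combination -h0)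
  · ext a b
    fin_cases a <;> fin_cases b <;>
      simp [nullMetric, Matrix.mul_apply, Fin.sum_univ_four]
    all_goals first | linear_combination hG | ring

theorem nullMetric_raised_radialField {h G : (Fin 4 → ℝ) → ℝ} {ε : ℝ → ℝ → ℝ} {x : Fin 4 → ℝ}
    (hG : G x ≠ 0) (a b : Fin 4) :
    raised (nullMetric h G) (radialField ε) a b x = -radialField ε x a b :=
  raised_radialField (nullMetric_inv hG) (by ring) a b

theorem radialField_closed (ε : ℝ → ℝ → ℝ) (x : Fin 4 → ℝ) (a b c : Fin 4) :
    pd a (fun y => radialField ε y b c) x + pd b (fun y => radialField ε y c a) x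
      + pd c (fun y => radialField ε y a b) x = 0 := by
  have h2 : pd 2 (fun y => ε (y 0) (y 1)) x = 0 := pd_two_liftRadial ε x
  have h3 : pd 3 (fun y => ε (y 0) (y 1)) x = 0 := pd_three_liftRadial ε x
  fin_cases a <;> fin_cases b <;> fin_cases c <;>
    simp [radialField, pd_const, pd_neg, h2, h3]

/-- The assumed matrix is `A` times the metric on the `(u, r)` block and `B` times it on the `(x,
y)` block. -/
theorem ricciMixed_nullMetric_of_ricci {h G : (Fin 4 → ℝ) → ℝ} {x : Fin 4 → ℝ} {A B : ℝ}
    (hG : G x ≠ 0)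
    (hric : ∀ a b, ricci (nullMetric h G) a b x =
      !![-h x * A, -A, 0, 0; -A, 0, 0, 0; 0, 0, G x * B, 0; 0, 0, 0, G x * B] a b) (a b : Fin 4) :
    ricciMixed (nullMetric h G) a b x = kronecker a b * ![A, A, B, B] a := by
  rw [ricciMixed, nullMetric_inv hG]
  simp only [hric]
  fin_cases a <;> fin_cases b <;> simp [Fin.sum_univ_four, kronecker]
  all_goals field_simp

theorem theorem1
    -- cosmological constant, and an arbitrary Lagrangian on its domain
    (Λ : ℝ) (L : ℝ → ℝ) (D : Set ℝ) (hD : IsOpen D) (hL : ContDiffOn ℝ ∞ L D)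
    -- static spherically symmetric solutions, depending on `k` integration constants;
    -- `W` is the set of pairs (constants, radius) where they are defined
    (k : ℕ) (W : Set ((Fin k → ℝ) × ℝ)) (hW : IsOpen W) (hWpos : ∀ p ∈ W, 0 < p.2)
    (f E : (Fin k → ℝ) → ℝ → ℝ)
    (hf : ContDiffOn ℝ ∞ (fun p : (Fin k → ℝ) × ℝ => f p.1 p.2) W)
    (hE : ContDiffOn ℝ ∞ (fun p : (Fin k → ℝ) × ℝ => E p.1 p.2) W)
    (hED : ∀ p ∈ W, -2 * E p.1 p.2 ^ 2 ∈ D)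
    (hsol : ∀ c : Fin k → ℝ, IsSSSSolution Λ L D {r | (c, r) ∈ W} (f c) (E c))
    -- the Robinson--Trautman functions, and the constants promoted to functions of `u`
    (U : Set ℝ) (hU : IsOpen U) (S : Set (ℝ × ℝ × ℝ)) (hS : IsOpen S) (hSU : ∀ p ∈ S, p.1 ∈ U)
    (P : ℝ → ℝ → ℝ → ℝ)
    (hP : ContDiffOn ℝ ∞ (fun p : ℝ × ℝ × ℝ => P p.1 p.2.1 p.2.2) S)
    (hPpos : ∀ p ∈ S, 0 < P p.1 p.2.1 p.2.2)
    (m : ℝ → ℝ) (hm : ContDiffOn ℝ ∞ m U)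
    (c : ℝ → Fin k → ℝ) (hc : ContDiffOn ℝ ∞ c U)
    (Q : ℝ → ℝ → ℝ) (hQ : ∀ u r, Q u r = f (c u) r)
    (hRT : ∀ u x y, (u, x, y) ∈ S → RTEquation P m u x y)
    (hcon : ∀ u r x y, (u, x, y) ∈ S → (c u, r) ∈ W → RTConstraint P Q u r x y) :
    IsEinsteinNESolution Λ L D
      {z : Fin 4 → ℝ | (z 0, z 2, z 3) ∈ S ∧ (c (z 0), z 1) ∈ W}
      (rtModifiedMetric Λ P m Q) (radialField fun u r => E (c u) r) := by
  set Ω : Set (Fin 4 → ℝ) := {z | (z 0, z 2, z 3) ∈ S ∧ (c (z 0), z 1) ∈ W} with hΩdef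
  set P' : (Fin 4 → ℝ) → ℝ := liftTransverse P with hP'
  set p : (Fin 4 → ℝ) → ℝ := liftTransverse (logP P) with hp'
  set M : (Fin 4 → ℝ) → ℝ := fun z => m (z 0) with hM'
  set K : (Fin 4 → ℝ) → ℝ := liftTransverse (rtLaplacian P (logP P)) with hK'
  set Q' : (Fin 4 → ℝ) → ℝ := liftRadial Q with hQ'
  set ε : ℝ → ℝ → ℝ := fun u r => E (c u) r with hε
  set E' : (Fin 4 → ℝ) → ℝ := liftRadial ε with hE'
  set q : (Fin 4 → ℝ) → ℝ := fun z => z 1 ^ 2 * deriv L (-2 * E' z ^ 2) * E' z with hq'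
  -- the domain is open
  have hφ : ContDiff ℝ ∞ fun z : Fin 4 → ℝ => (z 0, z 2, z 3) := by fun_prop
  have hψ : ∀ z ∈ Ω, ContDiffAt ℝ ∞ (fun z : Fin 4 → ℝ => (c (z 0), z 1)) z := fun z hz =>
    ((hc.contDiffAt (hU.mem_nhds (hSU _ hz.1))).comp z contDiffAt_coord).prodMk contDiffAt_coord
  have hΩ : IsOpen Ω := by
    rw [isOpen_iff_mem_nhds]
    intro z hz
    exact inter_mem (hφ.continuous.continuousAt.preimage_mem_nhds (hS.mem_nhds hz.1))
      ((hψ z hz).continuousAt.preimage_mem_nhds (hW.mem_nhds hz.2))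
  -- smoothness of the coefficients
  have sP : ∀ z ∈ Ω, ContDiffAt ℝ ∞ P' z := fun z hz =>
    ContDiffAt.comp (g := fun p : ℝ × ℝ × ℝ => P p.1 p.2.1 p.2.2) z
      (hP.contDiffAt (hS.mem_nhds hz.1)) hφ.contDiffAt
  have hP0 : ∀ z ∈ Ω, 0 < P' z := fun z hz => hPpos _ hz.1
  have sp : ∀ z ∈ Ω, ContDiffAt ℝ ∞ p z := fun z hz => (sP z hz).log (hP0 z hz).ne'
  have sM : ∀ z ∈ Ω, ContDiffAt ℝ ∞ M z := fun z hz =>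
    (hm.contDiffAt (hU.mem_nhds (hSU _ hz.1))).comp z contDiffAt_coord
  have hKeq : K = fun z => P' z ^ 2 * (pd 2 (pd 2 p) z + pd 3 (pd 3 p) z) :=
    funext fun z => liftTransverse_rtLaplacian P (logP P) z
  have sK : ∀ z ∈ Ω, ContDiffAt ℝ ∞ K z := fun z hz => by
    rw [hKeq]
    exact ((sP z hz).pow 2).mul ((sp z hz).pd.pd.add (sp z hz).pd.pd)
  have hQeq : Q' = fun z => f (c (z 0)) (z 1) := funext fun z => hQ _ _
  have sQ : ∀ z ∈ Ω, ContDiffAt ℝ ∞ Q' z := fun z hz => by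
    rw [hQeq]
    exact ContDiffAt.comp (g := fun p : (Fin k → ℝ) × ℝ => f p.1 p.2) z
      (hf.contDiffAt (hW.mem_nhds hz.2)) (hψ z hz)
  have sE : ∀ z ∈ Ω, ContDiffAt ℝ ∞ E' z := fun z hz =>
    ContDiffAt.comp (g := fun p : (Fin k → ℝ) × ℝ => E p.1 p.2) z
      (hE.contDiffAt (hW.mem_nhds hz.2)) (hψ z hz)
  have hr : ∀ z ∈ Ω, 0 < z 1 := fun z hz => hWpos _ hz.2
  have hdata : ∀ z ∈ Ω, IsRTData P' p M K Q' z := fun z hz =>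
    { coord_ne := (hr z hz).ne'
      conformal_ne := (hP0 z hz).ne'
      smooth_P := sP z hz
      smooth_p := sp z hz
      smooth_M := sM z hz
      smooth_K := sK z hz
      smooth_Q := sQ z hz
      pd_P := fun i => by
        have h : pd i p z = _ := pd_comp (i := i) (φ := Real.log) (f := P')
          (Real.differentiableAt_log (hP0 z hz).ne') (sP z hz)
        rw [h, Real.deriv_log]
        have := (hP0 z hz).ne'
        field_simp
      pd_p := pd_one_liftTransverse _ z
      pd_M := fun i hi => pd_comp_coord_of_ne hi
      pd_K := pd_one_liftTransverse _ z
      pd_Q_two := pd_two_liftRadial Q z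
      pd_Q_three := pd_three_liftRadial Q z
      curvature := congrFun hKeq z }
  -- the field equations of the static solutions
  have hinv : ∀ z ∈ Ω, -2 * E' z ^ 2 ∈ D := fun z hz => hED _ hz.2
  have hsss : ∀ z ∈ Ω,
      pd 1 (pd 1 Q') z / 2 + pd 1 Q' z / z 1 = L (-2 * E' z ^ 2) / 2 ∧
      pd 1 Q' z / z 1 + Q' z / z 1 ^ 2
        = L (-2 * E' z ^ 2) / 2 + 2 * E' z ^ 2 * deriv L (-2 * E' z ^ 2) ∧
      pd 1 q z = 0 := by
    intro z hz
    -- At fixed `u`, the radial slice is the static solution with constants `c(u)`.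
    have hι : ContDiff ℝ ∞ fun r : ℝ => (c (z 0), r) := by fun_prop
    have hR : IsOpen {r | (c (z 0), r) ∈ W} := hW.preimage hι.continuous
    have h := sss_field_equations hD hL hR (fun r hr => hWpos _ hr)
      (ContDiffOn.comp (g := fun p : (Fin k → ℝ) × ℝ => f p.1 p.2) hf hι.contDiffOn
        fun r hr => hr)
      (ContDiffOn.comp (g := fun p : (Fin k → ℝ) × ℝ => E p.1 p.2) hE hι.contDiffOn
        fun r hr => hr)
      (fun r hr => hED _ hr) (hsol (c (z 0))) hz.2
    have hQz : (fun s => Q (z 0) s) = f (c (z 0)) := funext fun s => hQ _ _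
    rw [hQ', pd_one_one_liftRadial, pd_one_liftRadial, hQz]
    have hQz' : liftRadial Q z = f (c (z 0)) (z 1) := hQ _ _
    rw [hQz']
    refine ⟨h.1, h.2.1, ?_⟩
    have h3 := pd_one_liftRadial (fun u r => r ^ 2 * deriv L (-2 * ε u r ^ 2) * ε u r) z
    exact h3.trans h.2.2
  have hcon' : ∀ z ∈ Ω, pd 0 p z * (z 1 * pd 1 Q' z - 2 * Q' z) + pd 0 Q' z = 0 := by
    intro z hz
    have h := hcon _ _ _ _ hz.1 hz.2
    rw [hQ', hp', pd_one_liftRadial, pd_zero_liftRadial, pd_zero_liftTransverse]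
    exact h
  have hRT' : ∀ z ∈ Ω, P' z ^ 2 * (pd 2 (pd 2 K) z + pd 3 (pd 3 K) z)
      + 12 * M z * pd 0 p z - 4 * pd 0 M z = 0 := by
    intro z hz
    have h := hRT _ _ _ hz.1
    rw [hK', ← liftTransverse_rtLaplacian, hp', pd_zero_liftTransverse, hM', pd_comp_coord]
    exact h
  -- the charge
  have sL' : ∀ z ∈ Ω, ContDiffAt ℝ ∞ (fun z => deriv L (-2 * E' z ^ 2)) z := fun z hz =>
    ContDiffAt.comp (g := deriv L) (f := fun z => -2 * E' z ^ 2) z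
      ((hL.deriv_of_isOpen (m := ∞) hD (by simp)).contDiffAt (hD.mem_nhds (hinv z hz)))
      (contDiffAt_const.mul ((sE z hz).pow 2))
  have sq : ∀ z ∈ Ω, ContDiffAt ℝ ∞ q z := fun z hz =>
    ((contDiffAt_coord.pow 2).mul (sL' z hz)).mul (sE z hz)
  have hmem : ∀ z ∈ Ω, ∀ᶠ y in 𝓝 z, y ∈ Ω := fun z hz => hΩ.mem_nhds hz
  have hchargeE : ∀ z ∈ Ω, (pd 0 q z - 2 * pd 0 p z * q z) * E' z = 0 := fun z hz =>
    pd_charge_mul_field (hr z hz).ne' ((hmem z hz).mono sp) ((hmem z hz).mono sQ) (sE z hz)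
      (sq z hz) ((hL.contDiffAt (hD.mem_nhds (hinv z hz))).differentiableAt (by simp))
      EventuallyEq.rfl (Eventually.of_forall fun y => pd_one_liftTransverse _ y)
      ((hmem z hz).mono fun y hy => (hsss y hy).1)
      ((hmem z hz).mono fun y hy => ⟨(hr y hy).ne', (hsss y hy).2.1⟩)
      ((hmem z hz).mono hcon')
  have hcharge : ∀ z ∈ Ω, pd 0 q z = 2 * pd 0 p z * q z := by
    intro z hz
    -- If points with `E ≠ 0` accumulate at `z`, the law for `q` holds at them and passes to `z` by
    -- continuity; otherwise `E`, and with it `q`, vanishes near `z`.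
    by_cases hfr : ∃ᶠ y in 𝓝 z, E' y ≠ 0
    · have hcont : ContinuousAt (fun y => pd 0 q y - 2 * pd 0 p y * q y) z :=
        ((sq z hz).pd.sub ((contDiffAt_const.mul (sp z hz).pd).mul (sq z hz))).continuousAt
      by_contra hne
      have hne' : pd 0 q z - 2 * pd 0 p z * q z ≠ 0 := sub_ne_zero.2 hne
      obtain ⟨y, hEy, hy, hyΩ⟩ :=
        (hfr.and_eventually ((hcont.eventually_ne hne').and (hmem z hz))).exists
      exact mul_ne_zero hy hEy (hchargeE y hyΩ)
    · have hE0 : ∀ᶠ y in 𝓝 z, E' y = 0 := by simpa [not_frequently] using hfr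
      have hq0 : q =ᶠ[𝓝 z] fun _ => 0 := hE0.mono fun y hy => by simp [hq', hy]
      rw [pd_congr hq0, pd_const, hq0.self_of_nhds]
      simp
  -- the metric
  set h : (Fin 4 → ℝ) → ℝ := rtPotential Λ p M K Q' with hh
  set G : (Fin 4 → ℝ) → ℝ := fun z => z 1 ^ 2 / P' z ^ 2 with hG
  have hg : rtModifiedMetric Λ P m Q = nullMetric h G := rtModifiedMetric_eq Λ P m Q
  have hGpos : ∀ z ∈ Ω, 0 < G z := fun z hz =>
    div_pos (pow_pos (hr z hz) 2) (pow_pos (hP0 z hz) 2)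
  have sh : ∀ z ∈ Ω, ContDiffAt ℝ ∞ h z := fun z hz => (hdata z hz).contDiffAt_rtPotential Λ
  have sG : ∀ z ∈ Ω, ContDiffAt ℝ ∞ G z := fun z hz =>
    (contDiffAt_coord.pow 2).div ((sP z hz).pow 2) (pow_ne_zero 2 (hP0 z hz).ne')
  have hF : ∀ z ∈ Ω, ∀ a b, raised (nullMetric h G) (radialField ε) a b z = -radialField ε z a b :=
    fun z hz a b => nullMetric_raised_radialField (hGpos z hz).ne' a b
  have hFinv : ∀ z ∈ Ω, fieldInvariant (nullMetric h G) (radialField ε) z = -2 * E' z ^ 2 :=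
    fun z hz => fieldInvariant_radialField (hF z hz)
  rw [hg]
  refine
    { isOpen_domain := hΩ
      metric_smooth := ?_
      metric_lorentzian := ?_
      field_smooth := ?_
      field_antisymm := ?_
      field_closed := fun z _ => radialField_closed ε z
      invariant_mem := fun z hz => by rw [hFinv z hz]; exact hinv z hz
      einstein_eq := ?_
      maxwell_eq := ?_ }
  · have s1 : ContDiffOn ℝ ∞ (fun z => -h z) Ω := fun z hz => (sh z hz).neg.contDiffWithinAt
    have s2 : ContDiffOn ℝ ∞ G Ω := fun z hz => (sG z hz).contDiffWithinAt
    intro a b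
    fin_cases a <;> fin_cases b <;>
      first | exact s1 | exact s2 | exact contDiffOn_const
  · intro z hz
    refine isLorentzian_nullMetric (k := P' z / z 1)
      (div_ne_zero (hP0 z hz).ne' (hr z hz).ne') ?_
    have h1 := (hP0 z hz).ne'
    have h2 := (hr z hz).ne'
    simp only [hG]
    field_simp
  · have s1 : ContDiffOn ℝ ∞ E' Ω := fun z hz => (sE z hz).contDiffWithinAt
    intro a b
    fin_cases a <;> fin_cases b <;>
      first | exact s1 | exact s1.neg | exact contDiffOn_const
  · intro z _ a b
    fin_cases a <;> fin_cases b <;> simp [radialField]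
  · intro z hz
    rw [einsteinNE_iff_ricciMixed L Λ (hF z hz)]
    have hev := hmem z hz
    intro a b
    have hric := ricciMixed_nullMetric_of_ricci (h := h) (G := G) (x := z)
      (A := Λ - (pd 1 (pd 1 Q') z / 2 + pd 1 Q' z / z 1))
      (B := Λ - (pd 1 Q' z / z 1 + Q' z / z 1 ^ 2)) (hGpos z hz).ne' (fun a b => by
        rw [ricci_nullMetric (sh z hz) (sp z hz) (sG z hz)
          (Eventually.of_forall fun y => pd_one_liftTransverse _ y)
          (hev.mono fun y hy => (hdata y hy).isConformalFactor),
          nullRicci_rtPotential (hev.mono hdata) (hRT' z hz) (hcon' z hz)]) a b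
    rw [hric, (hsss z hz).1, (hsss z hz).2.1]
    congr 1
    have hEz : ε (z 0) (z 1) = E' z := rfl
    rw [hEz]
    fin_cases a <;> simp <;> ring
  · intro z hz b
    -- Here `√(-g) = r²/P²`, so the densitized field is `q/P²` times a constant antisymmetric
    -- matrix, and only its `u`- and `r`-derivatives enter the equations.
    have hterm : ∀ a, pd a (fun y => Real.sqrt (-(nullMetric h G y).det)
        * deriv L (fieldInvariant (nullMetric h G) (radialField ε) y)
        * raised (nullMetric h G) (radialField ε) a b y) z
        = pd a (fun y => q y / P' y ^ 2 * !![0, -1, 0, 0; 1, 0, 0, 0; 0, 0, 0, 0; 0, 0, 0, 0] a b)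
          z := by
      intro a
      apply pd_congr
      filter_upwards [hmem z hz] with y hy
      rw [hFinv y hy, hF y hy, nullMetric_det, neg_neg, Real.sqrt_sq (hGpos y hy).le]
      have hEy : ε (y 0) (y 1) = E' y := rfl
      have h1 := (hP0 y hy).ne'
      fin_cases a <;> fin_cases b <;> simp [radialField, hEy, hq', hG] <;> field_simp
    simp only [hterm]
    have hP2 : P' z ^ 2 ≠ 0 := pow_ne_zero 2 (hP0 z hz).ne'
    have hqP : ∀ i, pd i q z = 2 * pd i p z * q z → pd i (fun y => q y / P' y ^ 2) z = 0 := by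
      intro i hi
      rw [pd_div (sq z hz) ((sP z hz).pow 2) hP2, pd_pow (sP z hz), hi, (hdata z hz).pd_P]
      push_cast
      rw [div_eq_zero_iff]
      left
      ring
    have h0 := hqP 0 (hcharge z hz)
    have h1 := hqP 1 (by rw [(hsss z hz).2.2, (hdata z hz).pd_p]; ring)
    fin_cases b <;> simp [Fin.sum_univ_four, pd_const, pd_neg, h0, h1]
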